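/- **Setting.** Let $d\ge 1$ and let $\mathcal X=\{0,1\}^{\mathbb Z^d}$, with shifts $(\tau_x\eta)_y=\eta_{y+x}$, $(\tau_xf)(\eta)=f(\tau_x\eta)$. Let $\eta^{x,y}$ be $\eta$ with the values at $x$ and $y$ exchanged, and $\pi_{x,y}f(\eta)=f(\eta^{x,y})-f(\eta)$. A bond is an unordered pair $b=\{x,y\}$ of nearest neighbours of $\mathbb Z^d$, written $x\sim y$; we write $\eta^b$ and $\pi_b$ for $\eta^{x,y}$ and $\pi_{x,y}$. The exchange rates $c_b=c_{x,y}=c_{y,x}:\mathcal X\to(0,\infty)$ are local ($c_{x,y}$ depends only on $\{\eta_z:\max_i|z_i-x_i|\le R\}$ for some $R$), spatially homogeneous ($c_{x,y}=\tau_xc_{0,y-x}$), and $c_{x,y}$ does not depend on $(\eta_x,\eta_y)$. For an integer $k$ let $\Lambda(k)=\{y\in\mathbb Z^d:\max_i|y_i|\le k\}$. For an integer $\ell\ge1$ put $\ell_*=2\ell+1$, so $|\Lambda(\ell)|=\ell_*^d$. For $0\le m\le\ell_*^d$, $\langle\cdot\rangle_{\Lambda(\ell),m}$ is the expectation under the uniform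 probability measure on $\mathcal X_{\Lambda(\ell),m}=\{\xi\in\{0,1\}^{\Lambda(\ell)}:\sum_x\xi_x=m\}$. For $\zeta\in\{0,1\}^{\Lambda(\ell)^c}$ let $\xi\cdot\zeta$ be the configuration equal to $\xi$ on $\Lambda(\ell)$ and to $\zeta$ off it, and $$L_{\Lambda(\ell),\zeta}f(\xi)=\sum_{b\subset\Lambda(\ell)}c_b(\xi\cdot\zeta)\,\pi_bf(\xi).$$ On functions on $\mathcal X_{\Lambda(\ell),m}$ with $\langle f\rangle_{\Lambda(\ell),m}=0$ the operator $-L_{\Lambda(\ell),\zeta}$ is invertible; for such $f,g$ put $$\Delta_{\ell,m,\zeta}(f,g)=\langle f\,(-L_{\Lambda(\ell),\zeta})^{-1}g\rangle_{\Lambda(\ell),m},\qquad \Delta_{\ell,m,\zeta}(f)=\Delta_{\ell,m,\zeta}(f,f).$$ Let $F:\mathcal X\to\mathbb R^d$ be a local function, i.e. depending on finitely many coordinates; let $r(F)$ be the least integer $r\ge1$ such that $F$ depends only on $\{\eta_x:x\in\Lambda(r)\}$, $\|F\|_\infty=\sup_\eta|F(\eta)|$, and $⦀F⦀_{0,\infty}=r(F)^d\|F\|_\infty$.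 With $n=r(F)+1$ and $LF=\sum_bc_b\,\pi_bF$ (sum over all bonds of $\mathbb Z^d$), define the $\mathbb R^d$-valued functions $$A_\ell(\xi)=\tfrac12\sum_{x,y\in\Lambda(\ell),\,x\sim y}(\xi_y-\xi_x)(y-x),\qquad B_{\ell,\zeta}(\xi)=\tfrac12\sum_{x,y\in\Lambda(\ell),\,x\sim y}c_{x,y}(\xi\cdot\zeta)(\xi_y-\xi_x)(y-x),$$ $$H_{\ell,\zeta,F}(\xi)=\sum_{x\in\Lambda(\ell-n)}\tau_x(LF)(\xi\cdot\zeta).$$ For $\theta\in\mathbb R^d$, $\theta\cdot A_\ell$ and $\theta\cdot(B_{\ell,\zeta}-H_{\ell,\zeta,F})$ have mean zero under every $\langle\cdot\rangle_{\Lambda(\ell),m}$. Finally, with $\langle\cdot\rangle_\rho$ the expectation under the Bernoulli product measure of density $\rho\in[0,1]$ on $\mathcal X$, put $\chi(\rho)=\rho-\rho^2$ and $$\theta\cdot\widehat c(\rho;F)\theta=\frac12\sum_{x\sim 0}\Big\langle c_{0,x}\Big(\theta\cdot\Big[x(\eta_x-\eta_0)-\sum_{y\in\mathbb Z^d}\pi_{0,x}(\tau_yF)\Big]\Big)^2\Big\rangle_\rho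 .$$ **Proposition 5.1.** There is a constant $C>0$, depending only on $d$ and the rates $(c_b)$, such that for every local $F:\mathcal X\to\mathbb R^d$, every integer $\ell\ge1$, all $\theta,\tilde\theta\in\mathbb R^d$ with $|\theta|=|\tilde\theta|=1$, every integer $0\le m\le\ell_*^d$ and every $\zeta\in\{0,1\}^{\Lambda(\ell)^c}$, $$\Big|\ell_*^{-d}\Delta_{\ell,m,\zeta}\big(\theta\cdot(B_{\ell,\zeta}-H_{\ell,\zeta,F})\big)-\tfrac12\,\theta\cdot\widehat c(m/\ell_*^d;F)\theta\Big|\le C\,r(F)^d\,(1+⦀F⦀_{0,\infty}^2)\,\ell^{-1}$$ and $$\Big|\ell_*^{-d}\Delta_{\ell,m,\zeta}\big(\tilde\theta\cdot A_\ell,\ \theta\cdot(B_{\ell,\zeta}-H_{\ell,\zeta,F})\big)-(\theta\cdot\tilde\theta)\,\chi(m/\ell_*^d)\Big|\le C\,r(F)^{2d}\,\|F\|_\infty\,\ell^{-d}+C\,\ell^{-1}.$$ -/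

import Mathlib

namespace NonGradientKawasaki

open MeasureTheory ProbabilityTheory

/-! ### Configurations, boxes, bonds -/

/-- The lattice `ℤ^d`. -/
abbrev Site (d : ℕ) : Type := Fin d → ℤ

/-- The configuration space `{0,1}^{ℤ^d}`; `true` means occupied. -/
abbrev Config (d : ℕ) : Type := Site d → Bool

/-- Euclidean space `ℝ^d`. -/
abbrev Vec (d : ℕ) : Type := EuclideanSpace ℝ (Fin d)

/-- The occupation number, `0` or `1`, as a real number. -/
def occ (b : Bool) : ℝ := if b then 1 else 0

/-- A lattice point as a vector of `ℝ^d`. -/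
def toVec {d : ℕ} (x : Site d) : Vec d := WithLp.toLp 2 fun i => (x i : ℝ)

/-- `{x, y}` is a nearest-neighbour bond of `ℤ^d`. -/
def Nbr {d : ℕ} (x y : Site d) : Prop := ∑ i, |x i - y i| = 1

instance {d : ℕ} (x y : Site d) : Decidable (Nbr x y) :=
  inferInstanceAs (Decidable (∑ i, |x i - y i| = 1))

/-- The cube `Λ(k) = {y ∈ ℤ^d : max_i |y_i| ≤ k}`; it is empty if `k < 0` and `d ≥ 1`. -/
noncomputable def box (d : ℕ) (k : ℤ) : Finset (Site d) := Finset.Icc (fun _ => -k) (fun _ => k)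

/-- The shift: `(τ_x η)_y = η_{y+x}`. It acts on functions by `(τ_x f)(η) = f (τ_x η)`. -/
def shift {d : ℕ} (x : Site d) (η : Config d) : Config d := fun y => η (y + x)

/-- The exchange `η^{x,y}` of the values at `x` and `y`. -/
def exch {α : Type*} [DecidableEq α] (x y : α) (η : α → Bool) : α → Bool :=
  fun z => η (Equiv.swap x y z)

/-- The configuration `ξ·ζ` on `ℤ^d` that equals `ξ` on `Λ(ℓ)` and `ζ` off `Λ(ℓ)`. -/
noncomputable def glue {d ℓ : ℕ} (ξ : box d ℓ → Bool) (ζ : {x : Site d // x ∉ box d ℓ} → Bool) : Config d :=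
  fun x => if h : x ∈ box d ℓ then ξ ⟨x, h⟩ else ζ ⟨x, h⟩

/-! ### Exchange rates and local functions -/

/-- Exchange rates `c_{x,y}(η)` of the Kawasaki dynamics, indexed by nearest-neighbour bonds:
non-degenerate, local, spatially homogeneous, and in detailed balance with Bernoulli measures.
Values at pairs `x, y` that are not neighbours are never used. -/
structure Rates (d : ℕ) where
  rate : Site d → Site d → Config d → ℝ
  symm : ∀ x y, Nbr x y → rate x y = rate y x
  pos : ∀ x y η, Nbr x y → 0 < rate x y η
  isLocal : ∃ R : ℕ, ∀ x y, Nbr x y → DependsOn (rate x y) {z | ∀ i, |z i - x i| ≤ (R : ℤ)}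
  homogeneous : ∀ x y η, Nbr x y → rate x y η = rate 0 (y - x) (shift x η)
  detailedBalance : ∀ x y, Nbr x y → DependsOn (rate x y) ({x, y}ᶜ : Set (Site d))

/-- `ℝ^d`-valued local functions on `{0,1}^{ℤ^d}`. -/
structure LocalFun (d : ℕ) where
  toFun : Config d → Vec d
  isLocal : ∃ S : Finset (Site d), DependsOn toFun (S : Set (Site d))

instance {d : ℕ} : CoeFun (LocalFun d) (fun _ => Config d → Vec d) := ⟨LocalFun.toFun⟩

/-- The radius `r(F) ≥ 1` of the support of `F`: the least integer `r ≥ 1` such that `F` depends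
only on the values in `Λ(r)`. -/
noncomputable def LocalFun.radius {d : ℕ} (F : LocalFun d) : ℕ :=
  sInf {r : ℕ | 0 < r ∧ DependsOn F (box d r : Set (Site d))}

/-- The sup norm `‖F‖_∞` (a supremum over finitely many values, as `F` is local). -/
noncomputable def LocalFun.supNorm {d : ℕ} (F : LocalFun d) : ℝ := ⨆ η, ‖F η‖

/-- The norm `⦀F⦀_{0,∞} = r(F)^d ‖F‖_∞`. -/
noncomputable def LocalFun.tripleNorm {d : ℕ} (F : LocalFun d) : ℝ :=
  (F.radius : ℝ) ^ d * F.supNorm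

/-! ### Grand canonical quantities -/

/-- The Bernoulli product measure `ν_ρ` on `{0,1}^{ℤ^d}`. -/
noncomputable def bernoulliProd (d : ℕ) (ρ : unitInterval) : Measure (Config d) :=
  Measure.infinitePi fun _ => bernoulliMeasure true false ρ

/-- The compressibility `χ(ρ) = ρ - ρ²`. -/
def compressibility (ρ : ℝ) : ℝ := ρ - ρ ^ 2

/-- `π_{0,x} (∑_{y ∈ ℤ^d} τ_y F) (η) = ∑_{y ∈ ℤ^d} (F(τ_y η^{0,x}) - F(τ_y η))`, a sum with
finitely many non-zero terms. -/
noncomputable def exchFormalSum {d : ℕ} (F : LocalFun d) (x : Site d) (η : Config d) : Vec d :=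
  ∑ᶠ y : Site d, (F (shift y (exch 0 x η)) - F (shift y η))

/-- The quadratic form `θ · ĉ(ρ;F) θ =
½ ∑_{|x|=1} ⟨ c_{0,x} (θ · (x (η_x - η_0) - π_{0,x} ∑_y τ_y F))² ⟩_ρ`. -/
noncomputable def conductivityForm {d : ℕ} (c : Rates d) (ρ : unitInterval) (F : LocalFun d)
    (θ : Vec d) : ℝ :=
  (1 / 2) * ∑ x ∈ (box d 1).filter (fun x => Nbr 0 x),
    ∫ η, c.rate 0 x η *
      (inner ℝ θ ((occ (η x) - occ (η 0)) • toVec x - exchFormalSum F x η)) ^ 2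
      ∂(bernoulliProd d ρ)

/-! ### Canonical measures and the localized generator -/

/-- The configurations on `Λ(ℓ)` with exactly `m` particles. -/
abbrev CanonConfig (d ℓ m : ℕ) : Type :=
  {ξ : box d ℓ → Bool // (Finset.univ.filter fun x => ξ x = true).card = m}

/-- The expectation `⟨f⟩_{Λ(ℓ),m}` under the uniform probability measure on the configurations
with `m` particles. -/
noncomputable def canonMean {d ℓ m : ℕ} (f : CanonConfig d ℓ m → ℝ) : ℝ :=
  (∑ ξ, f ξ) / Fintype.card (CanonConfig d ℓ m)

theorem card_exch {d ℓ : ℕ} (x y : box d ℓ) (ξ : box d ℓ → Bool) :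
    (Finset.univ.filter fun z => exch x y ξ z = true).card
      = (Finset.univ.filter fun z => ξ z = true).card := by
  refine Finset.card_bij (fun z _ => Equiv.swap x y z) ?_ ?_ ?_
  · intro a ha
    rw [Finset.mem_filter] at ha ⊢
    exact ⟨Finset.mem_univ _, ha.2⟩
  · intro a _ b _ h; exact (Equiv.swap x y).injective h
  · intro b hb
    rw [Finset.mem_filter] at hb
    refine ⟨Equiv.swap x y b, ?_, by simp⟩
    rw [Finset.mem_filter]
    exact ⟨Finset.mem_univ _, by simpa [exch] using hb.2⟩

/-- The exchange as a map of the space of configurations with `m` particles. -/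
def canonExch {d ℓ m : ℕ} (x y : box d ℓ) (ξ : CanonConfig d ℓ m) : CanonConfig d ℓ m :=
  ⟨exch x y ξ.1, (card_exch x y ξ.1).trans ξ.2⟩

/-- The localized Kawasaki generator with boundary condition `ζ`,
`L_{Λ(ℓ),ζ} f (ξ) = ∑_{b ∈ Λ(ℓ)^*} c_b(ξ·ζ) (f(ξ^b) - f(ξ))`; a sum over
undirected bonds is written as one half of the sum over ordered pairs of neighbours. -/
noncomputable def localGen {d ℓ m : ℕ} (c : Rates d) (ζ : {x : Site d // x ∉ box d ℓ} → Bool) :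
    (CanonConfig d ℓ m → ℝ) →ₗ[ℝ] (CanonConfig d ℓ m → ℝ) where
  toFun f ξ := (1 / 2) * ∑ x : box d ℓ, ∑ y : box d ℓ,
    if Nbr x.1 y.1 then c.rate x y (glue ξ.1 ζ) * (f (canonExch x y ξ) - f ξ) else 0
  map_add' f g := by
    funext ξ
    simp only [Pi.add_apply, ← mul_add, ← Finset.sum_add_distrib]
    refine congrArg _ (Finset.sum_congr rfl fun x _ => Finset.sum_congr rfl fun y _ => ?_)
    split_ifs <;> ring
  map_smul' a f := by
    funext ξ
    simp only [Pi.smul_apply, smul_eq_mul, RingHom.id_apply, Finset.mul_sum]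
    refine Finset.sum_congr rfl fun x _ => Finset.sum_congr rfl fun y _ => ?_
    split_ifs <;> ring

/-- The space of the functions with `⟨f⟩_{Λ(ℓ),m} = 0`. -/
noncomputable def meanZero (d ℓ m : ℕ) : Submodule ℝ (CanonConfig d ℓ m → ℝ) where
  carrier := {f | canonMean f = 0}
  zero_mem' := by simp [canonMean]
  add_mem' := by
    intro f g hf hg
    simp only [Set.mem_ofPred_eq, canonMean, Pi.add_apply, Finset.sum_add_distrib, add_div] at *
    rw [hf, hg, add_zero]
  smul_mem' := by
    intro a f hf
    simp only [Set.mem_ofPred_eq, canonMean, Pi.smul_apply, smul_eq_mul, ← Finset.mul_sum,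
      mul_div_assoc] at *
    rw [hf, mul_zero]

theorem mem_meanZero_of_sum {d ℓ m : ℕ} {f : CanonConfig d ℓ m → ℝ} (h : ∑ ξ, f ξ = 0) :
    f ∈ meanZero d ℓ m := by
  change canonMean f = 0
  simp [canonMean, h]

/-! #### Invertibility of the localized generator on functions of mean zero -/

theorem canonExch_canonExch {d ℓ m : ℕ} (x y : box d ℓ) (ξ : CanonConfig d ℓ m) :
    canonExch x y (canonExch x y ξ) = ξ := by
  apply Subtype.ext; funext z; simp [canonExch, exch]

theorem sum_eq_zero_of_exch {d ℓ m : ℕ} (x y : box d ℓ) (g : CanonConfig d ℓ m → ℝ)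
    (h : ∀ ξ, g (canonExch x y ξ) = - g ξ) : ∑ ξ, g ξ = 0 := by
  have h1 : ∑ ξ, g (canonExch x y ξ) = ∑ ξ, g ξ :=
    Equiv.sum_comp (⟨canonExch x y, canonExch x y, canonExch_canonExch x y,
      canonExch_canonExch x y⟩ : CanonConfig d ℓ m ≃ CanonConfig d ℓ m) g
  simp only [h, Finset.sum_neg_distrib] at h1
  linarith

theorem glue_exch {d ℓ : ℕ} (ξ : box d ℓ → Bool) (ζ : {x : Site d // x ∉ box d ℓ} → Bool)
    (x y : box d ℓ) : glue (exch x y ξ) ζ = exch x.1 y.1 (glue ξ ζ) := by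
  funext z
  by_cases hz : z ∈ box d ℓ
  · have key : ((Equiv.swap x y ⟨z, hz⟩ : box d ℓ) : Site d) = Equiv.swap x.1 y.1 z := by
      simp only [Equiv.swap_apply_def, Subtype.ext_iff]
      split_ifs <;> rfl
    have hz' : Equiv.swap x.1 y.1 z ∈ box d ℓ := key ▸ (Equiv.swap x y ⟨z, hz⟩ : box d ℓ).2
    simp only [glue, exch, hz, hz', dif_pos]
    exact congrArg ξ (Subtype.ext key)
  · have h1 : z ≠ x.1 := fun h => hz (h ▸ x.2)
    have h2 : z ≠ y.1 := fun h => hz (h ▸ y.2)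
    simp [glue, exch, hz, Equiv.swap_apply_of_ne_of_ne h1 h2]

theorem rate_exch {d : ℕ} (c : Rates d) {x y : Site d} (h : Nbr x y) (η : Config d) :
    c.rate x y (exch x y η) = c.rate x y η := by
  refine c.detailedBalance x y h fun z hz => ?_
  simp only [Set.mem_compl_iff, Set.mem_insert_iff, Set.mem_singleton_iff, not_or] at hz
  simp [exch, Equiv.swap_apply_of_ne_of_ne hz.1 hz.2]

theorem sum_localGen {d ℓ m : ℕ} (c : Rates d) (ζ : {x : Site d // x ∉ box d ℓ} → Bool)
    (f : CanonConfig d ℓ m → ℝ) : ∑ ξ, localGen c ζ f ξ = 0 := by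
  simp only [localGen, LinearMap.coe_mk, AddHom.coe_mk, ← Finset.mul_sum]
  rw [Finset.sum_comm, Finset.sum_eq_zero, mul_zero]
  intro x _
  rw [Finset.sum_comm, Finset.sum_eq_zero]
  intro y _
  apply sum_eq_zero_of_exch x y
  intro ξ
  split_ifs with h
  · rw [canonExch_canonExch]
    change c.rate x y (glue (exch x y ξ.1) ζ) * _ = _
    rw [glue_exch, rate_exch c h]; ring
  · simp

theorem sum_mul_localGen {d ℓ m : ℕ} (c : Rates d) (ζ : {x : Site d // x ∉ box d ℓ} → Bool)
    (f : CanonConfig d ℓ m → ℝ) :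
    ∑ ξ, f ξ * localGen c ζ f ξ = - (1 / 4) * ∑ x : box d ℓ, ∑ y : box d ℓ, ∑ ξ,
      if Nbr x.1 y.1 then c.rate x y (glue ξ.1 ζ) * (f (canonExch x y ξ) - f ξ) ^ 2 else 0 := by
  have h1 : ∑ ξ, f ξ * localGen c ζ f ξ = (1 / 2) * ∑ x : box d ℓ, ∑ y : box d ℓ,
      ∑ ξ : CanonConfig d ℓ m, f ξ *
      if Nbr x.1 y.1 then c.rate x y (glue ξ.1 ζ) * (f (canonExch x y ξ) - f ξ) else 0 := by
    simp only [localGen, LinearMap.coe_mk, AddHom.coe_mk, Finset.mul_sum]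
    rw [Finset.sum_comm]
    refine Finset.sum_congr rfl fun x _ => ?_
    rw [Finset.sum_comm]
    refine Finset.sum_congr rfl fun y _ => Finset.sum_congr rfl fun ξ _ => ?_
    ring
  have h2 : ∀ x y : box d ℓ, ∑ ξ : CanonConfig d ℓ m, (f ξ *
      (if Nbr x.1 y.1 then c.rate x y (glue ξ.1 ζ) * (f (canonExch x y ξ) - f ξ) else 0)
      + (1 / 2) * if Nbr x.1 y.1 then
          c.rate x y (glue ξ.1 ζ) * (f (canonExch x y ξ) - f ξ) ^ 2 else 0) = 0 := by
    intro x y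
    apply sum_eq_zero_of_exch x y
    intro ξ
    split_ifs with h
    · rw [canonExch_canonExch]
      have : glue (canonExch x y ξ).1 ζ = exch x.1 y.1 (glue ξ.1 ζ) := glue_exch ξ.1 ζ x y
      rw [this, rate_exch c h]; ring
    · simp
  rw [h1]
  simp only [Finset.mul_sum]
  refine Finset.sum_congr rfl fun x _ => Finset.sum_congr rfl fun y _ => ?_
  have h3 := h2 x y
  rw [Finset.sum_add_distrib, ← Finset.mul_sum] at h3
  rw [← Finset.mul_sum, ← Finset.mul_sum]
  linarith

theorem exch_invariant {d ℓ m : ℕ} (c : Rates d) (ζ : {x : Site d // x ∉ box d ℓ} → Bool)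
    (f : CanonConfig d ℓ m → ℝ) (hf : localGen c ζ f = 0) (x y : box d ℓ) (h : Nbr x.1 y.1)
    (ξ : CanonConfig d ℓ m) : f (canonExch x y ξ) = f ξ := by
  have h0 := sum_mul_localGen c ζ f
  simp only [hf, Pi.zero_apply, mul_zero, Finset.sum_const_zero] at h0
  have nn : ∀ x y : box d ℓ, ∀ ξ : CanonConfig d ℓ m, 0 ≤ if Nbr x.1 y.1 then
      c.rate x y (glue ξ.1 ζ) * (f (canonExch x y ξ) - f ξ) ^ 2 else 0 := by
    intro x y ξ
    split_ifs with h
    · exact mul_nonneg (c.pos _ _ _ h).le (sq_nonneg _)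
    · exact le_rfl
  have h1 : ∑ x : box d ℓ, ∑ y : box d ℓ, ∑ ξ : CanonConfig d ℓ m, (if Nbr x.1 y.1 then
      c.rate x y (glue ξ.1 ζ) * (f (canonExch x y ξ) - f ξ) ^ 2 else 0) = 0 := by linarith
  rw [Finset.sum_eq_zero_iff_of_nonneg fun x _ => Finset.sum_nonneg fun y _ =>
    Finset.sum_nonneg fun ξ _ => nn x y ξ] at h1
  have h2 := h1 x (Finset.mem_univ _)
  rw [Finset.sum_eq_zero_iff_of_nonneg fun y _ => Finset.sum_nonneg fun ξ _ => nn x y ξ] at h2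
  have h3 := h2 y (Finset.mem_univ _)
  rw [Finset.sum_eq_zero_iff_of_nonneg fun ξ _ => nn x y ξ] at h3
  have h4 := h3 ξ (Finset.mem_univ _)
  rw [if_pos h, mul_eq_zero, or_iff_right (c.pos _ _ _ h).ne', sq_eq_zero_iff] at h4
  linarith

theorem mem_box {d : ℕ} {k : ℤ} {x : Site d} : x ∈ box d k ↔ ∀ i, |x i| ≤ k := by
  simp only [box, Finset.mem_Icc, Pi.le_def, abs_le, forall_and]

/-- A configuration with `m` particles, with its sites permuted. -/
def canonPerm {d ℓ m : ℕ} (σ : Equiv.Perm (box d ℓ)) (ξ : CanonConfig d ℓ m) :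
    CanonConfig d ℓ m :=
  ⟨fun z => ξ.1 (σ z), by
    refine Eq.trans ?_ ξ.2
    refine Finset.card_bij (fun z _ => σ z) ?_ ?_ ?_
    · intro a ha
      rw [Finset.mem_filter] at ha ⊢
      exact ⟨Finset.mem_univ _, ha.2⟩
    · intro a _ b _ h; exact σ.injective h
    · intro b hb
      rw [Finset.mem_filter] at hb
      refine ⟨σ.symm b, ?_, by simp⟩
      rw [Finset.mem_filter]
      exact ⟨Finset.mem_univ _, by simpa using hb.2⟩⟩

theorem swap_origin {d ℓ : ℕ} (H : Subgroup (Equiv.Perm (box d ℓ)))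
    (hH : ∀ x y : box d ℓ, Nbr x.1 y.1 → Equiv.swap x y ∈ H) (o : box d ℓ) (ho : o.1 = 0) :
    ∀ (n : ℕ) (x : box d ℓ), ∑ i, (x.1 i).natAbs = n → Equiv.swap x o ∈ H := by
  intro n
  induction n with
  | zero =>
    intro x hx
    have : x = o := by
      apply Subtype.ext
      rw [ho]
      funext i
      have := (Finset.sum_eq_zero_iff.1 hx) i (Finset.mem_univ i)
      simpa using this
    rw [this, Equiv.swap_self]; exact H.one_mem
  | succ n ih =>
    intro x hx
    have : ∃ i, x.1 i ≠ 0 := by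
      by_contra hcon
      push Not at hcon
      simp [hcon] at hx
    obtain ⟨i, hi⟩ := this
    have hxm := mem_box.1 x.2
    let w : Site d := Function.update x.1 i (x.1 i - (x.1 i).sign)
    have hwi : w i = x.1 i - (x.1 i).sign := by simp [w]
    have hwj : ∀ j, j ≠ i → w j = x.1 j := fun j hj => by simp [w, hj]
    have hs : |x.1 i - (x.1 i).sign| ≤ |x.1 i| ∧ |x.1 i - (x.1 i - (x.1 i).sign)| = 1 ∧
        (x.1 i).natAbs = (x.1 i - (x.1 i).sign).natAbs + 1 := by
      rcases lt_or_gt_of_ne hi with h | h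
      · rw [Int.sign_eq_neg_one_of_neg h]
        refine ⟨?_, by simp, by omega⟩
        rw [abs_le, abs_of_neg h]; omega
      · rw [Int.sign_eq_one_of_pos h]
        refine ⟨?_, by simp, by omega⟩
        rw [abs_le, abs_of_pos h]; omega
    have hw : w ∈ box d ℓ := by
      rw [mem_box]
      intro j
      by_cases hj : j = i
      · subst hj; rw [hwi]; exact hs.1.trans (hxm j)
      · rw [hwj j hj]; exact hxm j
    have hn : Nbr x.1 w := by
      unfold Nbr
      rw [Finset.sum_eq_single i]
      · rw [hwi]; exact hs.2.1
      · intro j _ hj; rw [hwj j hj]; simp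
      · simp
    have hsum : ∑ j, (w j).natAbs = n := by
      rw [← Finset.add_sum_erase _ _ (Finset.mem_univ i)] at hx ⊢
      have : ∑ j ∈ Finset.univ.erase i, (w j).natAbs
          = ∑ j ∈ Finset.univ.erase i, (x.1 j).natAbs :=
        Finset.sum_congr rfl fun j hj => by rw [hwj j (Finset.ne_of_mem_erase hj)]
      rw [this, hwi]
      omega
    exact SubmonoidClass.swap_mem_trans H (hH x ⟨w, hw⟩ hn) (ih ⟨w, hw⟩ hsum)

theorem perm_invariant {d ℓ m : ℕ} (f : CanonConfig d ℓ m → ℝ)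
    (hf : ∀ x y : box d ℓ, Nbr x.1 y.1 → ∀ ξ, f (canonExch x y ξ) = f ξ)
    (σ : Equiv.Perm (box d ℓ)) (ξ : CanonConfig d ℓ m) : f (canonPerm σ ξ) = f ξ := by
  let H : Subgroup (Equiv.Perm (box d ℓ)) :=
    { carrier := {σ | ∀ ξ, f (canonPerm σ ξ) = f ξ}
      one_mem' := fun ξ => rfl
      mul_mem' := by
        intro a b ha hb ξ
        exact (hb (canonPerm a ξ)).trans (ha ξ)
      inv_mem' := by
        intro a ha ξ
        have h1 := ha (canonPerm a⁻¹ ξ)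
        have h2 : canonPerm a (canonPerm a⁻¹ ξ) = ξ := by
          apply Subtype.ext; funext z; simp [canonPerm]
        rw [h2] at h1
        exact h1.symm }
  have hH : ∀ x y : box d ℓ, Nbr x.1 y.1 → Equiv.swap x y ∈ H := fun x y h ξ => hf x y h ξ
  have ho : (0 : Site d) ∈ box d ℓ := by rw [mem_box]; intro i; simp
  have hsw : ∀ x y : box d ℓ, Equiv.swap x y ∈ H := by
    intro x y
    refine SubmonoidClass.swap_mem_trans H (swap_origin H hH ⟨0, ho⟩ rfl _ x rfl) ?_
    rw [Equiv.swap_comm]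
    exact swap_origin H hH ⟨0, ho⟩ rfl _ y rfl
  have htop : H = ⊤ := by
    rw [eq_top_iff, ← Equiv.Perm.closure_isSwap, Subgroup.closure_le]
    rintro _ ⟨x, y, -, rfl⟩
    exact hsw x y
  have : σ ∈ H := htop ▸ Subgroup.mem_top σ
  exact this ξ

theorem exists_canonPerm {d ℓ m : ℕ} (ξ ξ' : CanonConfig d ℓ m) : ∃ σ, canonPerm σ ξ = ξ' := by
  have hc : Fintype.card {x // ξ'.1 x = true} = Fintype.card {x // ξ.1 x = true} := by
    rw [Fintype.card_subtype, Fintype.card_subtype, ξ.2, ξ'.2]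
  let e := Fintype.equivOfCardEq hc
  refine ⟨e.extendSubtype, Subtype.ext (funext fun z => ?_)⟩
  change ξ.1 (e.extendSubtype z) = ξ'.1 z
  by_cases hz : ξ'.1 z = true
  · rw [hz]; exact e.extendSubtype_mem z hz
  · have := e.extendSubtype_not_mem z hz
    rw [Bool.not_eq_true] at hz this
    rw [hz, this]

/-- The operator `-L_{Λ(ℓ),ζ}` on the functions of mean zero. -/
noncomputable def negGen {d ℓ m : ℕ} (c : Rates d) (ζ : {x : Site d // x ∉ box d ℓ} → Bool) :
    meanZero d ℓ m →ₗ[ℝ] meanZero d ℓ m :=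
  (-localGen c ζ).restrict fun f _ => mem_meanZero_of_sum (by
    simp only [LinearMap.neg_apply, Pi.neg_apply, Finset.sum_neg_distrib, sum_localGen, neg_zero])

theorem negGen_injective {d ℓ m : ℕ} (c : Rates d)
    (ζ : {x : Site d // x ∉ box d ℓ} → Bool) :
    Function.Injective (negGen (m := m) c ζ) := by
  rw [← LinearMap.ker_eq_bot, LinearMap.ker_eq_bot']
  rintro ⟨f, hf⟩ h
  have h0 : localGen c ζ f = 0 := by
    have := congrArg Subtype.val h
    simpa [negGen] using this
  have hinv := perm_invariant f (exch_invariant c ζ f h0)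
  apply Subtype.ext
  funext ξ
  have hconst : ∀ ξ', f ξ' = f ξ := fun ξ' => by
    obtain ⟨σ, rfl⟩ := exists_canonPerm ξ ξ'
    exact hinv σ ξ
  have hm : canonMean f = 0 := hf
  have hcard : (Fintype.card (CanonConfig d ℓ m) : ℝ) ≠ 0 := by
    have : Nonempty (CanonConfig d ℓ m) := ⟨ξ⟩
    exact_mod_cast Fintype.card_ne_zero
  simp only [canonMean, hconst, Finset.sum_const, Finset.card_univ, nsmul_eq_mul] at hm
  rw [mul_div_cancel_left₀ _ hcard] at hm
  exact hm

/-- `-L_{Λ(ℓ),ζ}` as an invertible operator on the functions of mean zero. -/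
noncomputable def negGenEquiv {d ℓ m : ℕ} (c : Rates d)
    (ζ : {x : Site d // x ∉ box d ℓ} → Bool) : meanZero d ℓ m ≃ₗ[ℝ] meanZero d ℓ m :=
  LinearEquiv.ofInjectiveEndo (negGen c ζ) (negGen_injective c ζ)

/-- The CLT variance `Δ_{ℓ,m,ζ}(f,g) = ⟨f (-L_{Λ(ℓ),ζ})⁻¹ g⟩_{Λ(ℓ),m}`. -/
noncomputable def cltVar {d ℓ m : ℕ} (c : Rates d) (ζ : {x : Site d // x ∉ box d ℓ} → Bool)
    (f g : meanZero d ℓ m) : ℝ :=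
  canonMean fun ξ => f.1 ξ * ((negGenEquiv c ζ).symm g).1 ξ

/-! ### The functions `A_ℓ`, `B_ℓ`, `H_ℓ` -/

/-- `A_ℓ(ξ) = ½ ∑_{x,y ∈ Λ(ℓ), |x-y|=1} (ξ_y - ξ_x)(y - x)`. -/
noncomputable def gradA {d ℓ : ℕ} (ξ : box d ℓ → Bool) : Vec d :=
  (1 / 2 : ℝ) • ∑ x : box d ℓ, ∑ y : box d ℓ,
    if Nbr x.1 y.1 then (occ (ξ y) - occ (ξ x)) • toVec (y.1 - x.1) else 0

/-- `B_{ℓ,ζ}(ξ) = ½ ∑_{x,y ∈ Λ(ℓ), |x-y|=1} c_{x,y}(ξ·ζ) (ξ_y - ξ_x)(y - x)`. -/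
noncomputable def currentB {d ℓ : ℕ} (c : Rates d) (ζ : {x : Site d // x ∉ box d ℓ} → Bool)
    (ξ : box d ℓ → Bool) : Vec d :=
  (1 / 2 : ℝ) • ∑ x : box d ℓ, ∑ y : box d ℓ,
    if Nbr x.1 y.1 then
      (c.rate x y (glue ξ ζ) * (occ (ξ y) - occ (ξ x))) • toVec (y.1 - x.1) else 0

/-- The Kawasaki generator on `ℤ^d` applied to a local function,
`L F (η) = ∑_b c_b(η) (F(η^b) - F(η))`; only finitely many terms are non-zero. -/
noncomputable def latticeGen {d : ℕ} (c : Rates d) (F : LocalFun d) (η : Config d) : Vec d :=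
  (1 / 2 : ℝ) • ∑ᶠ p : Site d × Site d,
    if Nbr p.1 p.2 then c.rate p.1 p.2 η • (F (exch p.1 p.2 η) - F η) else 0

/-- `H_{ℓ,ζ,F}(ξ) = ∑_{x ∈ Λ(ℓ-n)} τ_x(L F)(ξ·ζ)` with `n = r(F) + 1`. -/
noncomputable def corrH {d ℓ : ℕ} (c : Rates d) (F : LocalFun d)
    (ζ : {x : Site d // x ∉ box d ℓ} → Bool) (ξ : box d ℓ → Bool) : Vec d :=
  ∑ x ∈ box d ((ℓ : ℤ) - (F.radius + 1)), latticeGen c F (shift x (glue ξ ζ))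

/-! #### They have mean zero -/

theorem occ_sub_exch {d ℓ m : ℕ} (x y : box d ℓ) (ξ : CanonConfig d ℓ m) :
    occ ((canonExch x y ξ).1 y) - occ ((canonExch x y ξ).1 x)
      = -(occ (ξ.1 y) - occ (ξ.1 x)) := by
  simp [canonExch, exch]

/-- `θ · A_ℓ` as a function of mean zero. -/
noncomputable def gradAMeanZero (d ℓ m : ℕ) (θ : Vec d) : meanZero d ℓ m :=
  ⟨fun ξ => inner ℝ θ (gradA ξ.1), by
    apply mem_meanZero_of_sum
    simp only [gradA, inner_smul_right, inner_sum, ← Finset.mul_sum]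
    rw [Finset.sum_comm, Finset.sum_eq_zero, mul_zero]
    intro x _
    rw [Finset.sum_comm, Finset.sum_eq_zero]
    intro y _
    apply sum_eq_zero_of_exch x y
    intro ξ
    split_ifs with h
    · rw [occ_sub_exch, inner_smul_right, inner_smul_right]; ring
    · simp⟩

theorem sum_currentB {d ℓ m : ℕ} (c : Rates d) (ζ : {x : Site d // x ∉ box d ℓ} → Bool)
    (θ : Vec d) : ∑ ξ : CanonConfig d ℓ m, inner ℝ θ (currentB c ζ ξ.1) = 0 := by
  simp only [currentB, inner_smul_right, inner_sum, ← Finset.mul_sum]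
  rw [Finset.sum_comm, Finset.sum_eq_zero, mul_zero]
  intro x _
  rw [Finset.sum_comm, Finset.sum_eq_zero]
  intro y _
  apply sum_eq_zero_of_exch x y
  intro ξ
  split_ifs with h
  · have : glue (canonExch x y ξ).1 ζ = exch x.1 y.1 (glue ξ.1 ζ) := glue_exch ξ.1 ζ x y
    rw [occ_sub_exch, inner_smul_right, inner_smul_right, this, rate_exch c h]; ring
  · simp

theorem LocalFun.radius_spec {d : ℕ} (F : LocalFun d) :
    0 < F.radius ∧ DependsOn F (box d F.radius : Set (Site d)) := by
  refine Nat.sInf_mem (s := {r : ℕ | 0 < r ∧ DependsOn F (box d r : Set (Site d))}) ?_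
  obtain ⟨S, hS⟩ := F.isLocal
  refine ⟨1 + ∑ x ∈ S, ∑ i, (x i).natAbs, by simp, hS.mono fun x hx => ?_⟩
  rw [Finset.mem_coe, mem_box]
  intro i
  have h1 : (x i).natAbs ≤ ∑ i, (x i).natAbs :=
    Finset.single_le_sum (f := fun i => (x i).natAbs) (fun _ _ => Nat.zero_le _)
      (Finset.mem_univ i)
  have h2 : ∑ i, (x i).natAbs ≤ ∑ x ∈ S, ∑ i, (x i).natAbs :=
    Finset.single_le_sum (f := fun x : Site d => ∑ i, (x i).natAbs) (fun _ _ => Nat.zero_le _) hx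
  rw [abs_le]
  omega

theorem nbr_coord {d : ℕ} {x y : Site d} (h : Nbr x y) (i : Fin d) : |x i - y i| ≤ 1 := by
  rw [← h]
  exact Finset.single_le_sum (f := fun i => |x i - y i|) (fun _ _ => abs_nonneg _)
    (Finset.mem_univ i)

theorem latticeGen_eq {d : ℕ} (c : Rates d) (F : LocalFun d) (η : Config d) :
    latticeGen c F η = (1 / 2 : ℝ) • ∑ p ∈ box d (F.radius + 1) ×ˢ box d (F.radius + 1),
      if Nbr p.1 p.2 then c.rate p.1 p.2 η • (F (exch p.1 p.2 η) - F η) else 0 := by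
  unfold latticeGen
  rw [finsum_eq_sum_of_support_subset]
  intro p hp
  rw [Function.mem_support, ne_eq, ite_eq_right_iff, Classical.not_imp] at hp
  obtain ⟨hn, hp⟩ := hp
  by_contra hmem
  apply hp
  have : F (exch p.1 p.2 η) = F η := by
    refine F.radius_spec.2 fun z hz => ?_
    rw [Finset.mem_coe, mem_box] at hz
    have hne : z ≠ p.1 ∧ z ≠ p.2 := by
      constructor
      · rintro rfl
        apply hmem
        simp only [Finset.coe_product, Set.mem_prod, Finset.mem_coe, mem_box]
        refine ⟨fun i => by linarith [hz i], fun i => ?_⟩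
        have h1 := nbr_coord hn i
        have h2 := hz i
        rw [abs_le] at *
        omega
      · rintro rfl
        apply hmem
        simp only [Finset.coe_product, Set.mem_prod, Finset.mem_coe, mem_box]
        refine ⟨fun i => ?_, fun i => by linarith [hz i]⟩
        have h1 := nbr_coord hn i
        have h2 := hz i
        rw [abs_le] at *
        omega
    simp [exch, Equiv.swap_apply_of_ne_of_ne hne.1 hne.2]
  rw [this, sub_self, smul_zero]

theorem shift_exch {d : ℕ} (x p q : Site d) (η : Config d) :
    shift x (exch (p + x) (q + x) η) = exch p q (shift x η) := by
  funext z
  simp only [shift, exch, Equiv.swap_apply_def, add_left_inj]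
  split_ifs <;> rfl

theorem exch_exch {d : ℕ} (p q : Site d) (η : Config d) : exch p q (exch p q η) = η := by
  funext z; simp [exch]

theorem sum_corrH {d ℓ m : ℕ} (c : Rates d) (F : LocalFun d)
    (ζ : {x : Site d // x ∉ box d ℓ} → Bool) (θ : Vec d) :
    ∑ ξ : CanonConfig d ℓ m, inner ℝ θ (corrH c F ζ ξ.1) = 0 := by
  simp only [corrH, latticeGen_eq, inner_smul_right, inner_sum]
  rw [Finset.sum_comm]
  refine Finset.sum_eq_zero fun x hx => ?_
  rw [← Finset.mul_sum, Finset.sum_comm, Finset.sum_eq_zero, mul_zero]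
  intro p hp
  rw [Finset.mem_product, mem_box, mem_box] at hp
  rw [mem_box] at hx
  have h1 : p.1 + x ∈ box d ℓ := by
    rw [mem_box]; intro i
    have := hp.1 i; have := hx i
    rw [abs_le] at *
    rw [Pi.add_apply]
    omega
  have h2 : p.2 + x ∈ box d ℓ := by
    rw [mem_box]; intro i
    have := hp.2 i; have := hx i
    rw [abs_le] at *
    rw [Pi.add_apply]
    omega
  apply sum_eq_zero_of_exch ⟨p.1 + x, h1⟩ ⟨p.2 + x, h2⟩
  intro ξ
  have hg : shift x (glue (canonExch ⟨p.1 + x, h1⟩ ⟨p.2 + x, h2⟩ ξ).1 ζ)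
      = exch p.1 p.2 (shift x (glue ξ.1 ζ)) := by
    rw [← shift_exch]
    exact congrArg (shift x) (glue_exch ξ.1 ζ ⟨p.1 + x, h1⟩ ⟨p.2 + x, h2⟩)
  split_ifs with h
  · rw [hg, exch_exch, rate_exch c h, inner_smul_right, inner_smul_right, inner_sub_right,
      inner_sub_right]
    ring
  · simp

/-- `θ · (B_{ℓ,ζ} - H_{ℓ,ζ,F})` as a function of mean zero. -/
noncomputable def currentBHMeanZero (d ℓ m : ℕ) (c : Rates d) (F : LocalFun d)
    (ζ : {x : Site d // x ∉ box d ℓ} → Bool) (θ : Vec d) : meanZero d ℓ m :=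
  ⟨fun ξ => inner ℝ θ (currentB c ζ ξ.1 - corrH c F ζ ξ.1), by
    apply mem_meanZero_of_sum
    simp only [inner_sub_right, Finset.sum_sub_distrib, sum_currentB, sum_corrH, sub_zero]⟩

/-! ### The error terms -/

/-- The number `ℓ_*^d = (2ℓ+1)^d` of sites of `Λ(ℓ)`. -/
def boxVol (d ℓ : ℕ) : ℕ := (2 * ℓ + 1) ^ d

/-- The density `m / ℓ_*^d`, for `0 ≤ m ≤ ℓ_*^d`. -/
noncomputable def density {d ℓ m : ℕ} (hm : m ≤ boxVol d ℓ) : unitInterval :=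
  ⟨(m : ℝ) / (boxVol d ℓ : ℝ), by positivity,
    div_le_one_of_le₀ (by exact_mod_cast hm) (by positivity)⟩

/-- `ℓ_*^{-d} Δ_{ℓ,m,ζ}(θ·(B_{ℓ,ζ} - H_{ℓ,ζ,F})) - ½ θ·ĉ(m/ℓ_*^d;F)θ`. -/
noncomputable def errQ4 {d : ℕ} (c : Rates d) (F : LocalFun d) (ℓ : ℕ) (θ : Vec d) {m : ℕ}
    (hm : m ≤ boxVol d ℓ) (ζ : {x : Site d // x ∉ box d ℓ} → Bool) : ℝ :=
  (boxVol d ℓ : ℝ)⁻¹ *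
      cltVar c ζ (currentBHMeanZero d ℓ m c F ζ θ) (currentBHMeanZero d ℓ m c F ζ θ)
    - (1 / 2) * conductivityForm c (density hm) F θ

/-- `ℓ_*^{-d} Δ_{ℓ,m,ζ}(θ'·A_ℓ, θ·(B_{ℓ,ζ} - H_{ℓ,ζ,F})) - (θ·θ') χ(m/ℓ_*^d)`. -/
noncomputable def errQ5 {d : ℕ} (c : Rates d) (F : LocalFun d) (ℓ : ℕ) (θ θ' : Vec d) {m : ℕ}
    (hm : m ≤ boxVol d ℓ) (ζ : {x : Site d // x ∉ box d ℓ} → Bool) : ℝ :=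
  (boxVol d ℓ : ℝ)⁻¹ *
      cltVar c ζ (gradAMeanZero d ℓ m θ') (currentBHMeanZero d ℓ m c F ζ θ)
    - inner ℝ θ θ' * compressibility (density hm)

end NonGradientKawasaki

open NonGradientKawasaki

/-! The inverse of the generator never has to be computed: the current is exactly `-L` of an
explicit potential. With `u = ∑_{x ∈ Λ(ℓ)} (θ·x) η_x + ∑_{z ∈ Λ(ℓ-n)} θ·τ_z F`, exchanging a bond
changes the first sum by minus the gradient across it. Every exchange that affects `τ_z F`, `z ∈
Λ(ℓ-n)`, takes place inside `Λ(ℓ)`, so `θ·(B - H) = -L u` (`neg_localGen_potential`). Hence `Δ(f,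
θ·(B - H)) = ⟨f u⟩` for every mean-zero `f`.

For `f = θ·(B - H)` this is the Dirichlet form of `u`, a sum over bonds of `⟨c_b (π_b u)²⟩`
(`cltVar_current_eq`). Well inside the box the summand is a translate of the local function
`bondForm`, whose Bernoulli mean is the contribution of one direction to `θ·ĉθ`. Two errors remain:
bonds within distance `O(r(F))` of the boundary, a fraction `O(r(F)/ℓ)` of all bonds, and the
replacement of the canonical measure by the Bernoulli measure.

The second error is controlled by `abs_urnMean_sub_integral_le`, an equivalence of ensembles with
error `5 B |S| / |U|` for a function bounded by `B` and supported on `S`. Linearity in `|S|`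
matters, since the support has volume of order `r(F)^d`. It comes from the Gibbs variational
inequality: sites are revealed one by one, the relative entropy of each step is bounded by a `χ²`
divergence, and the total is `O((|S|/|U|)²)`; testing with a multiple of `f` of size `|S|/|U|` gives
the linear error.

For `f = θ'·A` the corrector contributes exactly zero: it does not see the outer layer of the box,
so by exchangeability its correlations with the occupations there are all equal, and the sum of
gradients telescopes to nothing (`canonMean_gradA_mul_eq_zero`). In the linear part the exchange
symmetry reduces `⟨(η_y - η_x) u⟩` to `⟨(η_y - η_x)²⟩`, which is close to `2χ`. The covariance
therefore does not depend on `F`, and the error is `O(1/ℓ)`. -/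

namespace NonGradientKawasaki
open MeasureTheory ProbabilityTheory

/-! ### Sampling without replacement -/

section Urn

variable {ι : Type*} [DecidableEq ι]

/-- The configuration whose set of occupied sites is `A`. -/
def ofSet (A : Finset ι) : ι → Bool := fun x => decide (x ∈ A)

/-- The mean of `f` over the configurations with `m` particles, all in `U`. -/
noncomputable def urnMean (U : Finset ι) (m : ℕ) (f : (ι → Bool) → ℝ) : ℝ :=
  (∑ A ∈ U.powersetCard m, f (ofSet A)) / U.card.choose m

theorem update_ofSet_true (a : ι) (A : Finset ι) :
    Function.update (ofSet A) a true = ofSet (insert a A) := by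
  funext z
  by_cases h : z = a
  · subst h; simp [ofSet]
  · simp [ofSet, h]

theorem update_ofSet_false {a : ι} {A : Finset ι} (ha : a ∉ A) :
    Function.update (ofSet A) a false = ofSet A := by
  funext z
  by_cases h : z = a
  · subst h; simp [ofSet, ha]
  · simp [h]

/-- Conditioning on the site `a`: it is occupied with probability equal to the density, and the
remaining sites again form an urn. This is the recursion that drives the entropy estimate. -/
theorem urnMean_insert_succ {a : ι} {U : Finset ι} (ha : a ∉ U) {m : ℕ} (hm : m ≤ U.card)
    (f : (ι → Bool) → ℝ) :
    urnMean (insert a U) (m + 1) f =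
      ((m + 1 : ℕ) : ℝ) / ((U.card + 1 : ℕ) : ℝ) *
          urnMean U m (fun η => f (Function.update η a true)) +
      (1 - ((m + 1 : ℕ) : ℝ) / ((U.card + 1 : ℕ) : ℝ)) *
          urnMean U (m + 1) (fun η => f (Function.update η a false)) := by
  have hnot : ∀ {j : ℕ}, ∀ A ∈ U.powersetCard j, a ∉ A := fun A hA h =>
    ha ((Finset.mem_powersetCard.1 hA).1 h)
  have hsum : ∑ A ∈ (insert a U).powersetCard (m + 1), f (ofSet A) =
      ∑ A ∈ U.powersetCard m, f (Function.update (ofSet A) a true) +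
      ∑ A ∈ U.powersetCard (m + 1), f (Function.update (ofSet A) a false) := by
    rw [Finset.powersetCard_succ_insert ha, Finset.sum_union, Finset.sum_image, add_comm]
    · congr 1
      · exact Finset.sum_congr rfl fun A _ => by rw [update_ofSet_true]
      · exact Finset.sum_congr rfl fun A hA => by rw [update_ofSet_false (hnot A hA)]
    · intro A hA B hB h
      rw [← Finset.erase_insert (hnot A hA), h, Finset.erase_insert (hnot B hB)]
    · rw [Finset.disjoint_left]
      intro A hA hA'
      obtain ⟨B, -, rfl⟩ := Finset.mem_image.1 hA'
      exact hnot _ hA (Finset.mem_insert_self _ _)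
  unfold urnMean
  rw [hsum, Finset.card_insert_of_notMem ha]
  set N := U.card
  have c0 : (0 : ℝ) < N.choose m := by exact_mod_cast Nat.choose_pos hm
  have c2 : (0 : ℝ) < (N + 1).choose (m + 1) := by exact_mod_cast Nat.choose_pos (by omega)
  have e1 : ((N : ℝ) + 1) * N.choose m = (N + 1).choose (m + 1) * ((m : ℝ) + 1) := by
    exact_mod_cast Nat.add_one_mul_choose_eq N m
  have e3 : ((N + 1).choose (m + 1) : ℝ) = N.choose m + N.choose (m + 1) := by
    exact_mod_cast Nat.choose_succ_succ N m
  have hN : (0 : ℝ) < (N : ℝ) + 1 := by positivity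
  push_cast
  rw [add_div]
  congr 1
  · rw [div_mul_div_comm, e1]
    field_simp
  -- If `m = |U|`, every site is occupied: the sum over sets that avoid `a` is empty, and its weight
  -- is zero as well.
  · rcases hm.eq_or_lt with h | h
    · have h0 : U.powersetCard (m + 1) = ∅ := Finset.powersetCard_eq_empty.2 (by omega)
      simp [h0]
    · have c1 : (0 : ℝ) < N.choose (m + 1) := by exact_mod_cast Nat.choose_pos h
      have : 1 - ((m : ℝ) + 1) / (N + 1) = N.choose (m + 1) / (N + 1).choose (m + 1) := by
        field_simp
        nlinarith
      rw [this]
      field_simp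

theorem urnMean_insert_zero (a : ι) (U : Finset ι) (f : (ι → Bool) → ℝ) :
    urnMean (insert a U) 0 f = urnMean U 0 (fun η => f (Function.update η a false)) := by
  simp [urnMean, update_ofSet_false]

theorem dependsOn_update {S : Finset ι} {a : ι} {f : (ι → Bool) → ℝ}
    (hf : DependsOn f (insert a S : Finset ι)) (b : Bool) :
    DependsOn (fun η => f (Function.update η a b)) (S : Set ι) := by
  intro x y h
  refine hf fun i hi => ?_
  by_cases hia : i = a
  · subst hia; simp
  · simp only [Function.update_of_ne hia]
    exact h i (by simpa [hia] using hi)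

theorem abs_urnMean_le {U : Finset ι} {m : ℕ} {f : (ι → Bool) → ℝ} {B : ℝ} (hB : 0 ≤ B)
    (hf : ∀ η, |f η| ≤ B) : |urnMean U m f| ≤ B := by
  unfold urnMean
  rw [abs_div, Nat.abs_cast]
  refine div_le_of_le_mul₀ (by positivity) hB ?_
  refine (Finset.abs_sum_le_sum_abs _ _).trans ((Finset.sum_le_card_nsmul _ _ B fun A _ => hf _).trans ?_)
  rw [Finset.card_powersetCard, nsmul_eq_mul, mul_comm]

theorem urnMean_const {U : Finset ι} {m : ℕ} (hm : m ≤ U.card) (b : ℝ) :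
    urnMean U m (fun _ => b) = b := by
  have c0 : (0 : ℝ) < U.card.choose m := by exact_mod_cast Nat.choose_pos hm
  simp [urnMean, Finset.card_powersetCard]
  field_simp

theorem urnMean_smul {U : Finset ι} {m : ℕ} (f : (ι → Bool) → ℝ) (b : ℝ) :
    urnMean U m (fun η => b * f η) = b * urnMean U m f := by
  simp [urnMean, ← Finset.mul_sum, mul_div_assoc]

end Urn

/-! ### The Bernoulli product measure -/

section Product

variable {d : ℕ}

instance (ρ : unitInterval) : IsProbabilityMeasure (bernoulliProd d ρ) := by
  unfold bernoulliProd; infer_instance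

theorem measurable_of_dependsOn {S : Finset (Site d)} {f : Config d → ℝ}
    (hf : DependsOn f (S : Set (Site d))) : Measurable f := by
  obtain ⟨g, rfl⟩ := dependsOn_iff_exists_comp.1 hf
  exact (measurable_of_finite g).comp (measurable_pi_lambda _ fun i => measurable_pi_apply _)

theorem exists_bound_of_dependsOn {S : Finset (Site d)} {f : Config d → ℝ}
    (hf : DependsOn f (S : Set (Site d))) : ∃ B, ∀ η, |f η| ≤ B := by
  obtain ⟨g, rfl⟩ := dependsOn_iff_exists_comp.1 hf
  refine ⟨∑ x, |g x|, fun η => ?_⟩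
  exact Finset.single_le_sum (f := fun x => |g x|) (fun _ _ => abs_nonneg _) (Finset.mem_univ _)

theorem integrable_of_dependsOn {S : Finset (Site d)} {f : Config d → ℝ}
    (hf : DependsOn f (S : Set (Site d))) (μ : Measure (Config d)) [IsFiniteMeasure μ] :
    Integrable f μ := by
  obtain ⟨B, hB⟩ := exists_bound_of_dependsOn hf
  exact Integrable.of_bound (measurable_of_dependsOn hf).aestronglyMeasurable B
    (Filter.Eventually.of_forall hB)

/-- Resampling one coordinate independently preserves a product measure. This yields the Bernoulli
counterpart of the urn recursion. -/
theorem bernoulliProd_eq_map (ρ : unitInterval) (a : Site d) :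
    bernoulliProd d ρ = ((bernoulliMeasure true false ρ).prod (bernoulliProd d ρ)).map
      (fun q => Function.update q.2 a q.1) := by
  have hmeas : Measurable (fun q : Bool × Config d => Function.update q.2 a q.1) := by
    fun_prop
  refine (Measure.eq_infinitePi _ fun s t ht => ?_).symm
  rw [Measure.map_apply hmeas (MeasurableSet.pi s.countable_toSet fun i _ => ht i)]
  have hpre : (fun q : Bool × Config d => Function.update q.2 a q.1) ⁻¹' Set.pi s t =
      (if a ∈ s then t a else Set.univ) ×ˢ Set.pi (s.erase a : Finset (Site d)) t := by
    ext ⟨b, η⟩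
    simp only [Set.mem_preimage, Set.mem_pi, Finset.mem_coe, Set.mem_prod, Finset.mem_erase]
    constructor
    · intro h
      refine ⟨?_, fun i hi => ?_⟩
      · split_ifs with ha
        · simpa using h a ha
        · trivial
      · simpa [hi.1] using h i hi.2
    · rintro ⟨h1, h2⟩ i hi
      by_cases hia : i = a
      · subst hia; simpa [hi] using h1
      · simpa [hia] using h2 i ⟨hia, hi⟩
  rw [hpre, Measure.prod_prod, bernoulliProd, Measure.infinitePi_pi _ fun i _ => ht i]
  split_ifs with ha
  · rw [Finset.mul_prod_erase s (fun i => bernoulliMeasure true false ρ (t i)) ha]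
  · rw [Finset.erase_eq_of_notMem ha, measure_univ, one_mul]

theorem integral_bernoulliProd_update (ρ : unitInterval) {S : Finset (Site d)} (a : Site d)
    {f : Config d → ℝ} (hf : DependsOn f (insert a S : Finset (Site d))) :
    ∫ η, f η ∂bernoulliProd d ρ =
      (ρ : ℝ) * ∫ η, f (Function.update η a true) ∂bernoulliProd d ρ +
      (1 - (ρ : ℝ)) * ∫ η, f (Function.update η a false) ∂bernoulliProd d ρ := by
  have hmeas : Measurable (fun q : Bool × Config d => Function.update q.2 a q.1) := by
    fun_prop
  have hfm := measurable_of_dependsOn hf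
  obtain ⟨B, hB⟩ := exists_bound_of_dependsOn hf
  conv_lhs => rw [bernoulliProd_eq_map ρ a]
  rw [integral_map hmeas.aemeasurable hfm.aestronglyMeasurable, integral_prod]
  · rw [integral_bernoulliMeasure]
    simp
  · exact Integrable.of_bound (hfm.comp hmeas).aestronglyMeasurable B
      (Filter.Eventually.of_forall fun _ => hB _)

end Product

/-! ### Equivalence of ensembles -/

/-- Split `s = (s p / q) (q / p)` and use `log x ≤ x - 1` on each factor; the second factor produces
the `χ²` term. -/
theorem mul_log_le {q p s : ℝ} (hq : 0 ≤ q) (hp : 0 < p) (hs : 0 < s) :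
    q * Real.log s ≤ s * p - q + q * (q / p - 1) := by
  rcases hq.eq_or_lt with rfl | hq
  · simp; positivity
  · have h1 := Real.log_le_sub_one_of_pos (show 0 < s * p / q by positivity)
    have h2 := Real.log_le_sub_one_of_pos (show 0 < q / p by positivity)
    have h3 : Real.log s = Real.log (s * p / q) + Real.log (q / p) := by
      rw [← Real.log_mul (by positivity) (by positivity)]
      congr 1; field_simp
    have h4 : q * (s * p / q - 1) = s * p - q := by field_simp
    rw [h3, mul_add, ← h4]
    gcongr

/-- The two-point entropy inequality, with the relative entropy bounded by the `χ²` divergence. -/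
theorem log_convex_combination {q p a b : ℝ} (hq : 0 ≤ q) (hq1 : q ≤ 1) (hp : 0 < p) (hp1 : p < 1)
    (ha : 0 < a) (hb : 0 < b) :
    q * Real.log a + (1 - q) * Real.log b ≤
      Real.log (p * a + (1 - p) * b) + (q - p) ^ 2 / (p * (1 - p)) := by
  have hp' : 0 < 1 - p := by linarith
  set w := p * a + (1 - p) * b with hw
  have hw0 : 0 < w := by positivity
  have h1 := mul_log_le hq hp (show 0 < a / w by positivity)
  have h2 := mul_log_le (show 0 ≤ 1 - q by linarith) hp' (show 0 < b / w by positivity)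
  rw [Real.log_div ha.ne' hw0.ne'] at h1
  rw [Real.log_div hb.ne' hw0.ne'] at h2
  have h3 : a / w * p + b / w * (1 - p) = 1 := by
    field_simp; linarith
  have h4 : q * (q / p - 1) + (1 - q) * ((1 - q) / (1 - p) - 1) = (q - p) ^ 2 / (p * (1 - p)) := by
    field_simp; ring
  -- Adding `h1` and `h2`, the normalisation `h3` cancels the linear terms, and `h4` identifies what
  -- is left as the `χ²` divergence.
  nlinarith

/-- Closes the induction for the entropy bound. After one site is revealed, the density of the other
`N` sites is `q - (1-q)/N` or `q + q/N`, a random variable with mean `q` and variance `q(1-q)/N²`.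
The step then reduces to `k + k² ≤ (k+1)²`. -/
theorem variance_step {k N q p : ℝ} (hk : 0 ≤ k) (hN : k < N) (hq : 0 ≤ q) (hq1 : q ≤ 1) :
    q * (k * (q - (1 - q) / N - p) ^ 2 +
        (q - (1 - q) / N) * (1 - (q - (1 - q) / N)) * (k / (N - k)) ^ 2) +
      (1 - q) * (k * (q + q / N - p) ^ 2 +
        (q + q / N) * (1 - (q + q / N)) * (k / (N - k)) ^ 2) + (q - p) ^ 2 ≤
      (k + 1) * (q - p) ^ 2 + q * (1 - q) * ((k + 1) / (N - k)) ^ 2 := by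
  have hN0 : 0 < N := by linarith
  have hNk : 0 < N - k := by linarith
  set t := (k / (N - k)) ^ 2 with ht
  have ht0 : 0 ≤ t := by positivity
  have e : q * (k * (q - (1 - q) / N - p) ^ 2 +
        (q - (1 - q) / N) * (1 - (q - (1 - q) / N)) * t) +
      (1 - q) * (k * (q + q / N - p) ^ 2 +
        (q + q / N) * (1 - (q + q / N)) * t) + (q - p) ^ 2 =
      (k + 1) * (q - p) ^ 2 + q * (1 - q) * (k / N ^ 2 + (1 - 1 / N ^ 2) * t) := by
    field_simp; ring
  rw [e]
  have h1 : k / N ^ 2 ≤ k / (N - k) ^ 2 := by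
    gcongr; linarith
  have h2 : (1 - 1 / N ^ 2) * t ≤ t := by
    have : 0 ≤ 1 / N ^ 2 * t := by positivity
    linarith
  have h3 : k / (N - k) ^ 2 + t ≤ ((k + 1) / (N - k)) ^ 2 := by
    rw [ht, div_pow, div_pow, ← add_div]
    gcongr; nlinarith
  have h4 : k / N ^ 2 + (1 - 1 / N ^ 2) * t ≤ ((k + 1) / (N - k)) ^ 2 := by linarith
  have : 0 ≤ q * (1 - q) := mul_nonneg hq (by linarith)
  gcongr

theorem dependsOn_comp {ι : Type*} {f : (ι → Bool) → ℝ} {S : Set ι} (hf : DependsOn f S)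
    (g : ℝ → ℝ) : DependsOn (fun η => g (f η)) S := fun _ _ h => congrArg g (hf h)

theorem integral_exp_pos_of_dependsOn {d : ℕ} (ρ : unitInterval) {S : Finset (Site d)} {f : Config d → ℝ}
    (hf : DependsOn f (S : Set (Site d))) : 0 < ∫ η, Real.exp (f η) ∂bernoulliProd d ρ :=
  integral_exp_pos (integrable_of_dependsOn (dependsOn_comp hf Real.exp) _)

/-- The Gibbs variational inequality for sampling without replacement. -/
theorem urnMean_le_log {d : ℕ} (ρ : unitInterval) (h0 : 0 < (ρ : ℝ)) (h1 : (ρ : ℝ) < 1)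
    (S : Finset (Site d)) :
    ∀ (U : Finset (Site d)) (m : ℕ) (f : Config d → ℝ), S ⊆ U → S.card < U.card → m ≤ U.card →
      DependsOn f (S : Set (Site d)) →
      urnMean U m f ≤ Real.log (∫ η, Real.exp (f η) ∂bernoulliProd d ρ) +
        (S.card * ((m : ℝ) / U.card - ρ) ^ 2 +
          ((m : ℝ) / U.card) * (1 - (m : ℝ) / U.card) * (S.card / (U.card - S.card)) ^ 2) /
          (ρ * (1 - ρ)) := by
  induction S using Finset.induction_on with
  | empty =>
    intro U m f _ _ hm hf
    obtain ⟨b, rfl⟩ : ∃ b, f = fun _ => b :=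
      ⟨f fun _ => false, funext fun η => hf.mono (by simp) |>.empty _ _⟩
    simp [urnMean_const hm]
  | insert a S haS ih =>
    intro U m f hSU hcard hm hf
    have haU : a ∈ U := hSU (Finset.mem_insert_self _ _)
    obtain ⟨V, haV, rfl⟩ : ∃ V, a ∉ V ∧ insert a V = U :=
      ⟨U.erase a, Finset.notMem_erase _ _, Finset.insert_erase haU⟩
    have hSV : S ⊆ V := fun x hx => by
      have h := hSU (Finset.mem_insert_of_mem hx)
      rcases Finset.mem_insert.1 h with rfl | h
      · exact absurd hx haS
      · exact h
    rw [Finset.card_insert_of_notMem haS, Finset.card_insert_of_notMem haV] at *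
    have hk : S.card < V.card := by omega
    have hq0 := dependsOn_update hf false
    have hq1 := dependsOn_update hf true
    have hkR : (S.card : ℝ) < V.card := by exact_mod_cast hk
    have hNpos : (0 : ℝ) < V.card := by have : (0 : ℝ) ≤ S.card := by positivity
                                        linarith
    have hV1 : ((V.card + 1 : ℕ) : ℝ) = (V.card : ℝ) + 1 := by push_cast; ring
    have hS1 : ((S.card + 1 : ℕ) : ℝ) = (S.card : ℝ) + 1 := by push_cast; ring
    have hint := integral_bernoulliProd_update ρ a (dependsOn_comp hf Real.exp)
    have hA := integral_exp_pos_of_dependsOn ρ hq1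
    have hB := integral_exp_pos_of_dependsOn ρ hq0
    set A := ∫ η, Real.exp (f (Function.update η a true)) ∂bernoulliProd d ρ
    set B := ∫ η, Real.exp (f (Function.update η a false)) ∂bernoulliProd d ρ
    set N : ℝ := (V.card : ℝ)
    set k : ℝ := (S.card : ℝ)
    set p : ℝ := (ρ : ℝ)
    have hpp : 0 < p * (1 - p) := mul_pos h0 (by linarith)
    obtain ⟨q, hq⟩ : ∃ q : ℝ, q = (m : ℝ) / ((V.card + 1 : ℕ) : ℝ) := ⟨_, rfl⟩
    have hq_nonneg : 0 ≤ q := by rw [hq]; positivity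
    have hq_le : q ≤ 1 := by
      rw [hq]; exact div_le_one_of_le₀ (by exact_mod_cast hm) (by positivity)
    have hmq : (m : ℝ) = q * (N + 1) := by
      rw [hq, hV1]; field_simp
    have hstep := variance_step (p := p) (Nat.cast_nonneg S.card) hkR hq_nonneg hq_le
    have hlog := log_convex_combination hq_nonneg hq_le h0 h1 hA hB
    -- The induction hypothesis is applied to both conditional urns, with the shifted densities.
    -- `log_convex_combination` then merges the two logarithms at the cost `(q - p)² / (p (1 - p))`,
    -- which `variance_step` absorbs.
    have hmean : urnMean (insert a V) m f ≤
        q * (Real.log A + (k * (q - (1 - q) / N - p) ^ 2 +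
          (q - (1 - q) / N) * (1 - (q - (1 - q) / N)) * (k / (N - k)) ^ 2) / (p * (1 - p))) +
        (1 - q) * (Real.log B + (k * (q + q / N - p) ^ 2 +
          (q + q / N) * (1 - (q + q / N)) * (k / (N - k)) ^ 2) / (p * (1 - p))) := by
      have e0 : (m : ℝ) / N = q + q / N := by rw [hmq]; field_simp
      have I0 : m ≤ V.card → urnMean V m (fun η => f (Function.update η a false)) ≤
          Real.log B + (k * (q + q / N - p) ^ 2 +
          (q + q / N) * (1 - (q + q / N)) * (k / (N - k)) ^ 2) / (p * (1 - p)) := by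
        intro hm'
        have := ih V m _ hSV hk hm' hq0
        rwa [e0] at this
      rcases m with _ | m
      · have hq' : q = 0 := by rw [hq]; simp
        rw [urnMean_insert_zero]
        have := I0 (Nat.zero_le _)
        rw [hq'] at this ⊢
        simpa using this
      · have e1 : (m : ℝ) / N = q - (1 - q) / N := by
          have : (m : ℝ) = q * (N + 1) - 1 := by rw [← hmq]; push_cast; ring
          rw [this]; field_simp; ring
        have I1 := ih V m _ hSV hk (by omega) hq1
        rw [e1] at I1
        rw [urnMean_insert_succ haV (by omega), ← hq]
        refine add_le_add (mul_le_mul_of_nonneg_left I1 hq_nonneg) ?_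
        -- In the full urn the branch with `a` empty is impossible, so the induction hypothesis is
        -- not available for it; there `q = 1` and its weight vanishes.
        rcases (show m + 1 ≤ V.card + 1 from hm).eq_or_lt with h | h
        · have : q = 1 := by
            rw [hq, h]; exact div_self (Nat.cast_ne_zero.2 (Nat.succ_ne_zero _))
          simp [this]
        · exact mul_le_mul_of_nonneg_left (I0 (by omega)) (by linarith)
    rw [hint, ← hq, hV1, hS1]
    have e2 : N + 1 - (k + 1) = N - k := by ring
    rw [e2]
    have := div_le_div_of_nonneg_right hstep hpp.le
    rw [add_div, add_div, mul_div_assoc, mul_div_assoc] at this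
    rw [mul_add, mul_add] at hmean
    linarith

/-- The entropy inequality is applied to `(t/B) f` with `t = |S|/|U|`. Since `ρ` equals the urn
density, the entropy cost is at most `4t²`; the second-order term of the exponential costs `t²`.
Division by `t/B` gives `5 B t`. -/
theorem urnMean_le_integral {d : ℕ} (ρ : unitInterval) {S U : Finset (Site d)} {m : ℕ}
    {f : Config d → ℝ} {B : ℝ} (hρ0 : 0 < (ρ : ℝ)) (hρ1 : (ρ : ℝ) < 1)
    (hρ : (ρ : ℝ) = (m : ℝ) / U.card) (hSU : S ⊆ U) (hS : 0 < S.card)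
    (hcard : 2 * S.card ≤ U.card) (hm : m ≤ U.card) (hf : DependsOn f (S : Set (Site d)))
    (hB : 0 < B) (hfB : ∀ η, |f η| ≤ B) :
    urnMean U m f ≤ ∫ η, f η ∂bernoulliProd d ρ + 5 * B * S.card / U.card := by
  set k : ℝ := (S.card : ℝ) with hk
  set N : ℝ := (U.card : ℝ) with hN
  have hk0 : 0 < k := Nat.cast_pos.2 hS
  have hkN : 2 * k ≤ N := by rw [hk, hN]; exact_mod_cast hcard
  have hN0 : 0 < N := by linarith
  set t : ℝ := k / N with ht
  have ht0 : 0 < t := by positivity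
  have ht1 : t ≤ 1 := by rw [ht, div_le_one hN0]; linarith
  have hg : DependsOn (fun η => t / B * f η) (S : Set (Site d)) := dependsOn_comp hf fun x => t / B * x
  have hgb : ∀ η, |t / B * f η| ≤ t := by
    intro η
    rw [abs_mul, abs_of_pos (by positivity : 0 < t / B)]
    calc t / B * |f η| ≤ t / B * B := by gcongr; exact hfB η
      _ = t := by field_simp
  have hmain := urnMean_le_log ρ hρ0 hρ1 S U m _ hSU (by omega) hm hg
  rw [urnMean_smul, ← hρ, ← hk, ← hN] at hmain
  have hexp : ∫ η, Real.exp (t / B * f η) ∂bernoulliProd d ρ ≤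
      1 + t / B * ∫ η, f η ∂bernoulliProd d ρ + t ^ 2 := by
    have i1 := integrable_of_dependsOn (dependsOn_comp hg Real.exp) (bernoulliProd d ρ)
    have i2 := integrable_of_dependsOn hg (bernoulliProd d ρ)
    have : ∫ η, Real.exp (t / B * f η) ∂bernoulliProd d ρ ≤
        ∫ η, (1 + t / B * f η) + t ^ 2 ∂bernoulliProd d ρ := by
      refine integral_mono i1 (((integrable_const _).add i2).add (integrable_const _)) fun η => ?_
      have h1 := abs_le.1 (Real.abs_exp_sub_one_sub_id_le ((hgb η).trans ht1))
      have h2 : (t / B * f η) ^ 2 ≤ t ^ 2 := sq_le_sq' (abs_le.1 (hgb η)).1 (abs_le.1 (hgb η)).2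
      simp only
      linarith [h1.2]
    have e : ∫ η, (1 + t / B * f η) + t ^ 2 ∂bernoulliProd d ρ =
        1 + t / B * ∫ η, f η ∂bernoulliProd d ρ + t ^ 2 := by
      refine (integral_add ((integrable_const _).add i2) (integrable_const _)).trans ?_
      refine congrArg₂ _ ((integral_add (integrable_const _) i2).trans ?_) (by simp)
      rw [integral_const_mul]; simp
    rwa [e] at this
  have hlog : Real.log (∫ η, Real.exp (t / B * f η) ∂bernoulliProd d ρ) ≤
      t / B * ∫ η, f η ∂bernoulliProd d ρ + t ^ 2 := by
    have := Real.log_le_sub_one_of_pos (integral_exp_pos_of_dependsOn ρ hg)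
    linarith
  have hvar : (k * ((ρ : ℝ) - ρ) ^ 2 + ρ * (1 - ρ) * (k / (N - k)) ^ 2) / (ρ * (1 - ρ)) ≤
      4 * t ^ 2 := by
    have hpp : (0 : ℝ) < ρ * (1 - ρ) := mul_pos hρ0 (by linarith)
    rw [sub_self, zero_pow two_ne_zero, mul_zero, zero_add, mul_div_cancel_left₀ _ hpp.ne']
    have : k / (N - k) ≤ 2 * t := by
      rw [ht, mul_div_assoc', div_le_div_iff₀ (by linarith) hN0]
      nlinarith
    calc (k / (N - k)) ^ 2 ≤ (2 * t) ^ 2 := by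
          gcongr
          exact div_nonneg hk0.le (by linarith)
      _ = 4 * t ^ 2 := by ring
  have h5 : t / B * urnMean U m f ≤ t / B * (∫ η, f η ∂bernoulliProd d ρ + 5 * B * t) := by
    have : t / B * (5 * B * t) = 5 * t ^ 2 := by field_simp
    rw [mul_add, this]
    linarith
  have := le_of_mul_le_mul_left h5 (by positivity)
  rwa [ht, mul_div_assoc'] at this

/-- At densities 0 and 1 the `χ²` bound divides by zero, but both measures are then the same point
mass as seen from `S`. -/
theorem urnMean_eq_integral_of_degenerate {d m : ℕ} (ρ : unitInterval) {U : Finset (Site d)} {S : Finset (Site d)}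
    (hρ : (ρ : ℝ) = (m : ℝ) / U.card) (hSU : S ⊆ U) (hm : m ≤ U.card)
    (h : (ρ : ℝ) = 0 ∨ (ρ : ℝ) = 1) {f : Config d → ℝ} (hf : DependsOn f (S : Set (Site d))) :
    urnMean U m f = ∫ η, f η ∂bernoulliProd d ρ := by
  rcases U.eq_empty_or_nonempty with rfl | hU
  · have hf' := hf.mono (show (S : Set (Site d)) ⊆ ∅ by simpa using hSU)
    obtain ⟨b, rfl⟩ : ∃ b, f = fun _ => b := ⟨f fun _ => false, funext fun η => hf'.empty _ _⟩
    simp [urnMean_const hm]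
  have hN : (U.card : ℝ) ≠ 0 := by exact_mod_cast hU.card_pos.ne'
  rcases h with h | h
  · have hm0 : m = 0 := by
      rw [h] at hρ
      rcases div_eq_zero_iff.1 hρ.symm with h | h
      · exact_mod_cast h
      · exact absurd h hN
    have : ρ = 0 := Subtype.ext h
    subst this hm0
    simp only [bernoulliProd, bernoulliMeasure_zero, Measure.infinitePi_dirac,
      integral_dirac]
    simp [urnMean]
    rfl
  · have hmU : m = U.card := by
      rw [h] at hρ
      have := (div_eq_one_iff_eq hN).1 hρ.symm
      exact_mod_cast this
    have : ρ = 1 := Subtype.ext h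
    subst this hmU
    simp only [bernoulliProd, bernoulliMeasure_one, Measure.infinitePi_dirac, integral_dirac]
    simp only [urnMean, Finset.powersetCard_self, Finset.sum_singleton, Nat.choose_self,
      Nat.cast_one, div_one]
    exact hf fun i hi => by simp [ofSet, hSU hi]

/-- Equivalence of ensembles, with an error linear in the size of the support. -/
theorem abs_urnMean_sub_integral_le {d m : ℕ} (ρ : unitInterval) {S U : Finset (Site d)}
    {f : Config d → ℝ} {B : ℝ} (hρ : (ρ : ℝ) = (m : ℝ) / U.card) (hSU : S ⊆ U)
    (hm : m ≤ U.card) (hf : DependsOn f (S : Set (Site d))) (hfB : ∀ η, |f η| ≤ B) :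
    |urnMean U m f - ∫ η, f η ∂bernoulliProd d ρ| ≤ 5 * B * S.card / U.card := by
  have hB0 : 0 ≤ B := (abs_nonneg _).trans (hfB fun _ => false)
  have hR : 0 ≤ 5 * B * S.card / U.card := by positivity
  by_cases hdeg : (ρ : ℝ) = 0 ∨ (ρ : ℝ) = 1
  · rw [urnMean_eq_integral_of_degenerate ρ hρ hSU hm hdeg hf, sub_self, abs_zero]; exact hR
  push Not at hdeg
  have hρ0 : 0 < (ρ : ℝ) := lt_of_le_of_ne ρ.2.1 hdeg.1.symm
  have hρ1 : (ρ : ℝ) < 1 := lt_of_le_of_ne ρ.2.2 hdeg.2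
  have hconst : ∀ b, (∀ η, f η = b) →
      |urnMean U m f - ∫ η, f η ∂bernoulliProd d ρ| ≤ 5 * B * S.card / U.card := by
    intro b hb
    obtain rfl : f = fun _ => b := funext hb
    simpa [urnMean_const hm] using hR
  rcases S.eq_empty_or_nonempty with rfl | hS
  · exact hconst (f fun _ => false) fun η => (hf.mono (by simp)).empty _ _
  rcases hB0.eq_or_lt with hB | hB
  · exact hconst 0 fun η => abs_nonpos_iff.1 (hB ▸ hfB η)
  by_cases hcard : 2 * S.card ≤ U.card
  · have h1 := urnMean_le_integral ρ hρ0 hρ1 hρ hSU hS.card_pos hcard hm hf hB hfB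
    have h2 := urnMean_le_integral ρ (f := fun η => -1 * f η) hρ0 hρ1 hρ hSU hS.card_pos hcard hm
      (dependsOn_comp hf fun x => -1 * x) hB (fun η => by simpa using hfB η)
    rw [urnMean_smul, integral_const_mul] at h2
    rw [abs_le]
    constructor <;> linarith
  -- When `S` fills more than half of `U`, the claimed error exceeds the trivial bound `2B`.
  · have h1 := abs_urnMean_le (U := U) (m := m) hB0 hfB
    have h2 : |∫ η, f η ∂bernoulliProd d ρ| ≤ B := by
      have := norm_integral_le_of_norm_le_const (μ := bernoulliProd d ρ) (f := f)
        (Filter.Eventually.of_forall hfB)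
      simpa using this
    have hU : (0 : ℝ) < U.card := by
      exact_mod_cast hS.card_pos.trans_le (Finset.card_le_card hSU)
    have h3 : 2 * B ≤ 5 * B * S.card / U.card := by
      rw [le_div_iff₀ hU]
      have : (U.card : ℝ) ≤ 2 * S.card := by exact_mod_cast (not_le.1 hcard).le
      nlinarith
    rw [abs_le] at *
    constructor <;> linarith

/-! ### The potential of the current -/

section Potential

variable {d ℓ m : ℕ}

theorem glue_canonExch (x y : box d ℓ) (ξ : CanonConfig d ℓ m)
    (ζ : {x : Site d // x ∉ box d ℓ} → Bool) :
    glue (canonExch x y ξ).1 ζ = exch x.1 y.1 (glue ξ.1 ζ) := glue_exch ξ.1 ζ x y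

theorem glue_apply (ξ : box d ℓ → Bool) (ζ : {x : Site d // x ∉ box d ℓ} → Bool) (x : box d ℓ) :
    glue ξ ζ x.1 = ξ x := by
  simp [glue]

theorem Nbr.ne {x y : Site d} (h : Nbr x y) : x ≠ y := by
  rintro rfl
  simp [Nbr] at h

theorem Nbr.symm {x y : Site d} (h : Nbr x y) : Nbr y x := by
  unfold Nbr at *
  rw [← h]
  exact Finset.sum_congr rfl fun i _ => abs_sub_comm _ _

theorem nbr_add_right {x y z : Site d} : Nbr (x + z) (y + z) ↔ Nbr x y := by
  simp [Nbr]

theorem toVec_sub (x y : Site d) : toVec (x - y) = toVec x - toVec y := by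
  ext i; simp [toVec]

theorem toVec_neg (x : Site d) : toVec (-x) = -toVec x := by
  ext i; simp [toVec]

theorem exch_left (x y : Site d) (η : Config d) : exch x y η x = η y := by simp [exch]

theorem exch_right (x y : Site d) (η : Config d) : exch x y η y = η x := by simp [exch]

theorem exch_other {x y z : Site d} (h : z ≠ x) (h' : z ≠ y) (η : Config d) :
    exch x y η z = η z := by simp [exch, Equiv.swap_apply_of_ne_of_ne h h']

/-- `∑_{x ∈ Λ(ℓ)} (θ · x) η_x`. -/
noncomputable def moment (ℓ : ℕ) (θ : Vec d) (η : Config d) : ℝ :=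
  ∑ x ∈ box d ℓ, occ (η x) * inner ℝ θ (toVec x)

/-- `∑_{z ∈ Λ(ℓ - n)} θ · τ_z F`, with `n = r(F) + 1`. -/
noncomputable def corrector (ℓ : ℕ) (θ : Vec d) (F : LocalFun d) (η : Config d) : ℝ :=
  ∑ z ∈ box d ((ℓ : ℤ) - (F.radius + 1)), inner ℝ θ (F (shift z η))

theorem moment_exch (θ : Vec d) {x y : Site d} (hx : x ∈ box d ℓ) (hy : y ∈ box d ℓ) (η : Config d) :
    moment ℓ θ (exch x y η) - moment ℓ θ η =
      -((occ (η y) - occ (η x)) * inner ℝ θ (toVec (y - x))) := by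
  rcases eq_or_ne x y with rfl | hxy
  · have : exch x x η = η := by funext z; simp [exch]
    simp [this]
  unfold moment
  rw [← Finset.sum_sub_distrib, ← Finset.sum_subset (s₁ := {x, y}), Finset.sum_pair hxy,
    exch_left, exch_right, toVec_sub, inner_sub_right]
  · ring
  · intro z hz
    rcases Finset.mem_insert.1 hz with rfl | hz
    · exact hx
    · rwa [Finset.mem_singleton.1 hz]
  · intro z _ hz
    rw [Finset.mem_insert, Finset.mem_singleton, not_or] at hz
    rw [exch_other hz.1 hz.2, sub_self]

theorem shift_exch' (z x y : Site d) (η : Config d) :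
    shift z (exch x y η) = exch (x - z) (y - z) (shift z η) := by
  rw [← shift_exch, sub_add_cancel, sub_add_cancel]

theorem LocalFun.shift_exch_of_notMem (F : LocalFun d) {x y z : Site d}
    (hx : x - z ∉ box d F.radius) (hy : y - z ∉ box d F.radius) (η : Config d) :
    F (shift z (exch x y η)) = F (shift z η) := by
  rw [shift_exch']
  refine F.radius_spec.2 fun w hw => ?_
  refine exch_other ?_ ?_ _
  · rintro rfl; exact hx hw
  · rintro rfl; exact hy hw

theorem rate_shift (c : Rates d) {x y : Site d} (h : Nbr x y) (z : Site d) (η : Config d) :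
    c.rate x y (shift z η) = c.rate (x + z) (y + z) η := by
  rw [c.homogeneous _ _ _ h, c.homogeneous _ _ _ (nbr_add_right.2 h), add_sub_add_right_eq_sub]
  congr 1
  funext w
  simp [shift, add_assoc]

/-- The choice `n = r(F) + 1` is made for this: a bond that changes `τ_z F` has an endpoint within
`r(F)` of `z`, hence both endpoints within `r(F) + 1`, hence inside `Λ(ℓ)`. The lattice generator
may be replaced by the one of the box. -/
theorem latticeGen_shift (c : Rates d) (F : LocalFun d) {z : Site d}
    (hz : z ∈ box d ((ℓ : ℤ) - (F.radius + 1))) (η : Config d) :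
    latticeGen c F (shift z η) = (1 / 2 : ℝ) • ∑ x : box d ℓ, ∑ y : box d ℓ,
      if Nbr x.1 y.1 then c.rate x y η • (F (shift z (exch x y η)) - F (shift z η)) else 0 := by
  let g : Site d × Site d → Vec d := fun p =>
    if Nbr p.1 p.2 then c.rate p.1 p.2 η • (F (shift z (exch p.1 p.2 η)) - F (shift z η)) else 0
  have h1 : latticeGen c F (shift z η) = (1 / 2 : ℝ) • ∑ᶠ p, g p := by
    unfold latticeGen
    rw [← finsum_comp_equiv ((Equiv.addRight z).prodCongr (Equiv.addRight z)) (f := g)]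
    congr 1
    refine finsum_congr fun p => ?_
    simp only [g, Equiv.prodCongr_apply, Prod.map_fst, Prod.map_snd, Equiv.coe_addRight,
      nbr_add_right, shift_exch]
    split_ifs with h
    · rw [rate_shift c h]
    · rfl
  have hsupp : ∀ p, g p ≠ 0 → p.1 ∈ box d ℓ ∧ p.2 ∈ box d ℓ := by
    intro p hp
    have hn : Nbr p.1 p.2 := by
      by_contra h; exact hp (if_neg h)
    have key : p.1 - z ∈ box d F.radius ∨ p.2 - z ∈ box d F.radius := by
      by_contra h
      push Not at h
      apply hp
      simp only [g, F.shift_exch_of_notMem h.1 h.2, sub_self, smul_zero, ite_self]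
    simp only [mem_box, abs_le, Pi.sub_apply] at key hz ⊢
    rw [← forall_and]
    intro i
    have h1 := nbr_coord hn i
    have h2 := hz i
    rw [abs_le] at h1
    rcases key with h | h <;> (have := h i; omega)
  have h2 : ∑ᶠ p, g p = ∑ p ∈ box d ℓ ×ˢ box d ℓ, g p := by
    refine finsum_eq_sum_of_support_subset _ fun p hp => ?_
    simpa using hsupp p hp
  rw [h1, h2, Finset.sum_product, ← Finset.sum_coe_sort (box d ℓ)]
  congr 1
  refine Finset.sum_congr rfl fun x _ => ?_
  rw [← Finset.sum_coe_sort (box d ℓ)]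

/-- The current `θ · (B - H)` is `-L` applied to a potential. -/
theorem neg_localGen_potential (c : Rates d) (F : LocalFun d)
    (ζ : {x : Site d // x ∉ box d ℓ} → Bool) (θ : Vec d) (ξ : CanonConfig d ℓ m) :
    -localGen c ζ (fun ξ : CanonConfig d ℓ m =>
      moment ℓ θ (glue ξ.1 ζ) + corrector ℓ θ F (glue ξ.1 ζ)) ξ =
      inner ℝ θ (currentB c ζ ξ.1 - corrH c F ζ ξ.1) := by
  set η := glue ξ.1 ζ with hη
  have hB : inner ℝ θ (currentB c ζ ξ.1) = (1 / 2) * ∑ x : box d ℓ, ∑ y : box d ℓ,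
      if Nbr x.1 y.1 then c.rate x y η * ((occ (η y) - occ (η x)) * inner ℝ θ (toVec (y.1 - x.1)))
      else 0 := by
    simp only [currentB, inner_smul_right, inner_sum]
    congr 1
    refine Finset.sum_congr rfl fun x _ => Finset.sum_congr rfl fun y _ => ?_
    split_ifs
    · rw [inner_smul_right, hη, glue_apply, glue_apply]; ring
    · simp
  have hH : inner ℝ θ (corrH c F ζ ξ.1) = (1 / 2) * ∑ x : box d ℓ, ∑ y : box d ℓ,
      if Nbr x.1 y.1 then c.rate x y η * (corrector ℓ θ F (exch x y η) - corrector ℓ θ F η)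
      else 0 := by
    unfold corrH
    rw [inner_sum, Finset.sum_congr rfl fun z hz => by
      rw [latticeGen_shift c F hz, inner_smul_right], ← Finset.mul_sum]
    congr 1
    simp only [inner_sum]
    rw [Finset.sum_comm]
    refine Finset.sum_congr rfl fun x _ => ?_
    rw [Finset.sum_comm]
    refine Finset.sum_congr rfl fun y _ => ?_
    split_ifs
    · simp only [corrector, inner_smul_right, inner_sub_right, ← Finset.sum_sub_distrib,
        Finset.mul_sum]
      rfl
    · simp
  rw [inner_sub_right, hB, hH, localGen]
  simp only [LinearMap.coe_mk, AddHom.coe_mk, glue_canonExch, ← hη]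
  rw [← mul_neg, ← mul_sub, ← Finset.sum_neg_distrib, ← Finset.sum_sub_distrib]
  congr 1
  refine Finset.sum_congr rfl fun x _ => ?_
  rw [← Finset.sum_neg_distrib, ← Finset.sum_sub_distrib]
  refine Finset.sum_congr rfl fun y _ => ?_
  split_ifs
  · have := moment_exch θ x.2 y.2 η
    linear_combination (-c.rate x y η) * this
  · simp

theorem localGen_const (c : Rates d) (ζ : {x : Site d // x ∉ box d ℓ} → Bool) (b : ℝ) :
    localGen c ζ (fun _ : CanonConfig d ℓ m => b) = 0 := by
  funext ξ; simp [localGen]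

/-- Any preimage of `g` under `-L` can be used, centred or not: `L` kills constants, and `f` has
mean zero. -/
theorem cltVar_eq_canonMean (c : Rates d) (ζ : {x : Site d // x ∉ box d ℓ} → Bool)
    (f g : meanZero d ℓ m) (w : CanonConfig d ℓ m → ℝ)
    (hw : ∀ ξ, -localGen c ζ w ξ = g.1 ξ) :
    cltVar c ζ f g = canonMean fun ξ => f.1 ξ * w ξ := by
  have hf : ∑ ξ, f.1 ξ * canonMean w = 0 := by
    have h : canonMean f.1 = 0 := f.2
    rw [← Finset.sum_mul]
    rcases div_eq_zero_iff.1 h with h | h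
    · rw [h, zero_mul]
    · have : IsEmpty (CanonConfig d ℓ m) := Fintype.card_eq_zero_iff.1 (by exact_mod_cast h)
      simp
  have hmem : (fun ξ => w ξ - canonMean w) ∈ meanZero d ℓ m := by
    apply mem_meanZero_of_sum
    rw [Finset.sum_sub_distrib, Finset.sum_const, nsmul_eq_mul, Finset.card_univ]
    rcases isEmpty_or_nonempty (CanonConfig d ℓ m) with h | h
    · simp
    · have : (Fintype.card (CanonConfig d ℓ m) : ℝ) ≠ 0 := by exact_mod_cast Fintype.card_ne_zero
      unfold canonMean
      field_simp
      simp
  have hsymm : (negGenEquiv c ζ).symm g = ⟨_, hmem⟩ := by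
    rw [LinearEquiv.symm_apply_eq]
    apply Subtype.ext
    funext ξ
    have e : (fun ξ => w ξ - canonMean w) = w - fun _ => canonMean w := rfl
    have : g.1 ξ = -localGen c ζ (fun ξ => w ξ - canonMean w) ξ := by
      rw [e, map_sub, localGen_const, sub_zero, hw]
    exact this
  unfold cltVar
  rw [hsymm]
  simp only [canonMean, mul_sub, Finset.sum_sub_distrib]
  simp only [canonMean] at hf
  rw [hf, sub_zero]

/-! ### Canonical means -/

/-- Identifies a configuration with its set of occupied sites. The boundary condition disappears
because `f` does not look outside the box. -/
theorem canonMean_glue (ζ : {x : Site d // x ∉ box d ℓ} → Bool) {f : Config d → ℝ}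
    (hf : DependsOn f (box d ℓ : Set (Site d))) :
    canonMean (fun ξ : CanonConfig d ℓ m => f (glue ξ.1 ζ)) = urnMean (box d ℓ) m f := by
  have key : ∀ f : Config d → ℝ, DependsOn f (box d ℓ : Set (Site d)) →
      ∑ ξ : CanonConfig d ℓ m, f (glue ξ.1 ζ) =
        ∑ A ∈ (box d ℓ).powersetCard m, f (ofSet A) := by
    intro f hf
    refine Finset.sum_bij
      (fun ξ _ => (Finset.univ.filter fun x => ξ.1 x = true).map (Function.Embedding.subtype _))
      ?_ ?_ ?_ ?_
    · intro ξ _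
      rw [Finset.mem_powersetCard, Finset.card_map]
      refine ⟨fun x hx => ?_, ξ.2⟩
      obtain ⟨y, -, rfl⟩ := Finset.mem_map.1 hx
      exact y.2
    · intro ξ _ ξ' _ h
      have h := Finset.map_injective _ h
      apply Subtype.ext
      funext x
      have := Finset.ext_iff.1 h x
      simp only [Finset.mem_filter, Finset.mem_univ, true_and] at this
      exact Bool.eq_iff_iff.2 this
    · intro A hA
      rw [Finset.mem_powersetCard] at hA
      have e : (Finset.univ.filter fun x : box d ℓ => decide (x.1 ∈ A) = true).map
          (Function.Embedding.subtype _) = A := by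
        ext x
        simp only [Finset.mem_map, Finset.mem_filter, Finset.mem_univ, true_and,
          decide_eq_true_eq, Function.Embedding.subtype_apply]
        constructor
        · rintro ⟨y, hy, rfl⟩; exact hy
        · intro hx; exact ⟨⟨x, hA.1 hx⟩, hx, rfl⟩
      refine ⟨⟨fun x => decide (x.1 ∈ A), ?_⟩, Finset.mem_univ _, e⟩
      rw [← hA.2]
      conv_rhs => rw [← e]
      rw [Finset.card_map]
    · intro ξ _
      refine hf fun x hx => ?_
      have hx' : x ∈ box d ℓ := hx
      simp [glue, ofSet, hx']
  have hcard := key (fun _ => 1) (fun _ _ _ => rfl)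
  unfold canonMean urnMean
  rw [key f hf]
  simp only [Finset.sum_const, Finset.card_powersetCard, nsmul_eq_mul, mul_one,
    Finset.card_univ] at hcard
  rw [hcard]

theorem abs_canonMean_le {f : CanonConfig d ℓ m → ℝ} {B : ℝ} (hB : 0 ≤ B)
    (hf : ∀ ξ, |f ξ| ≤ B) : |canonMean f| ≤ B := by
  unfold canonMean
  rw [abs_div, Nat.abs_cast]
  refine div_le_of_le_mul₀ (by positivity) hB ?_
  refine (Finset.abs_sum_le_sum_abs _ _).trans
    ((Finset.sum_le_card_nsmul _ _ B fun A _ => hf _).trans ?_)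
  rw [Finset.card_univ, nsmul_eq_mul, mul_comm]

theorem canonMean_comp_canonExch (x y : box d ℓ) (f : CanonConfig d ℓ m → ℝ) :
    canonMean (fun ξ => f (canonExch x y ξ)) = canonMean f := by
  unfold canonMean
  congr 1
  exact Equiv.sum_comp (⟨canonExch x y, canonExch x y, canonExch_canonExch x y,
      canonExch_canonExch x y⟩ : CanonConfig d ℓ m ≃ CanonConfig d ℓ m) f

theorem canonMean_sum {α : Type*} (s : Finset α) (f : α → CanonConfig d ℓ m → ℝ) :
    canonMean (fun ξ => ∑ a ∈ s, f a ξ) = ∑ a ∈ s, canonMean (f a) := by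
  unfold canonMean
  rw [Finset.sum_comm, Finset.sum_div]

theorem canonMean_add (f g : CanonConfig d ℓ m → ℝ) :
    canonMean (fun ξ => f ξ + g ξ) = canonMean f + canonMean g := by
  simp [canonMean, Finset.sum_add_distrib, add_div]

theorem canonMean_mul_left (b : ℝ) (f : CanonConfig d ℓ m → ℝ) :
    canonMean (fun ξ => b * f ξ) = b * canonMean f := by
  simp [canonMean, ← Finset.mul_sum, mul_div_assoc]

end Potential

/-! ### Averages over bonds -/

section Averages

variable {d : ℕ}

theorem card_box (d : ℕ) (k : ℕ) : (box d k).card = boxVol d k := by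
  unfold box boxVol
  rw [Pi.card_Icc]
  simp only [Int.card_Icc, Finset.prod_const, Finset.card_univ, Fintype.card_fin]
  congr 1
  omega

theorem box_mono {j k : ℤ} (h : j ≤ k) : box d j ⊆ box d k := fun x hx => by
  rw [mem_box] at *
  exact fun i => (hx i).trans h

theorem boxVol_pos (d ℓ : ℕ) : (0 : ℝ) < boxVol d ℓ := by
  have : 0 < boxVol d ℓ := by unfold boxVol; positivity
  exact_mod_cast this

theorem le_boxVol (hd : 1 ≤ d) (ℓ : ℕ) : (ℓ : ℝ) ≤ boxVol d ℓ := by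
  have : ℓ ≤ boxVol d ℓ := by
    unfold boxVol
    calc ℓ ≤ 2 * ℓ + 1 := by omega
      _ ≤ _ := Nat.le_self_pow (by omega) _
  exact_mod_cast this

theorem card_boundary_le (hd : 1 ≤ d) {ℓ : ℕ} (hℓ : 1 ≤ ℓ) (K : ℕ) :
    ((box d ℓ \ box d ((ℓ : ℤ) - K)).card : ℝ) ≤ boxVol d ℓ * (d * K / ℓ) := by
  have hN := boxVol_pos d ℓ
  have hℓ0 : (0 : ℝ) < ℓ := by exact_mod_cast hℓ
  have hd1 : (1 : ℝ) ≤ d := by exact_mod_cast hd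
  rcases le_or_gt K ℓ with hK | hK
  · have hcast : (ℓ : ℤ) - K = ((ℓ - K : ℕ) : ℤ) := by omega
    rw [hcast, Finset.card_sdiff_of_subset (box_mono (by omega)), card_box, card_box,
      Nat.cast_sub (by unfold boxVol; gcongr; omega)]
    have hKR : (K : ℝ) ≤ ℓ := by exact_mod_cast hK
    have h1 : (boxVol d (ℓ - K) : ℝ) = (1 + -(2 * K / (2 * ℓ + 1) : ℝ)) ^ d * boxVol d ℓ := by
      unfold boxVol
      push_cast [Nat.cast_sub hK]
      rw [← mul_pow]
      congr 1
      field_simp; ring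
    have h2 : (2 * K / (2 * ℓ + 1) : ℝ) ≤ K / ℓ := by
      rw [div_le_div_iff₀ (by positivity) hℓ0]
      have : (0 : ℝ) ≤ K := by positivity
      nlinarith
    have h2' : (2 * K / (2 * ℓ + 1) : ℝ) ≤ 1 := by
      rw [div_le_one (by positivity)]; linarith
    -- The smaller cube occupies the fraction `(1 - 2K/(2ℓ+1))^d` of the box; Bernoulli's inequality
    -- bounds it from below by `1 - dK/ℓ`.
    have h3 := one_add_mul_le_pow (show (-2 : ℝ) ≤ -(2 * K / (2 * ℓ + 1) : ℝ) by linarith) d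
    have h4 : 1 - d * K / ℓ ≤ (1 + -(2 * K / (2 * ℓ + 1) : ℝ)) ^ d := by
      refine le_trans ?_ h3
      have : (d : ℝ) * (2 * K / (2 * ℓ + 1)) ≤ d * (K / ℓ) := by gcongr
      rw [mul_div_assoc]
      linarith
    rw [h1]
    nlinarith
  · have h1 : ((box d ℓ \ box d ((ℓ : ℤ) - K)).card : ℝ) ≤ boxVol d ℓ := by
      rw [← card_box]
      exact_mod_cast Finset.card_le_card Finset.sdiff_subset
    have h2 : (1 : ℝ) ≤ d * K / ℓ := by
      rw [le_div_iff₀ hℓ0]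
      have : (ℓ : ℝ) ≤ K := by exact_mod_cast hK.le
      nlinarith
    nlinarith

theorem abs_average_sub_le (hd : 1 ≤ d) {ℓ : ℕ} (hℓ : 1 ≤ ℓ) (K : ℕ) {a : Site d → ℝ} {t M ε : ℝ}
    (hε : 0 ≤ ε) (hM : 0 ≤ M) (h1 : ∀ x ∈ box d ℓ, |a x - t| ≤ M)
    (h2 : ∀ x ∈ box d ((ℓ : ℤ) - K), |a x - t| ≤ ε) :
    |(boxVol d ℓ : ℝ)⁻¹ * ∑ x ∈ box d ℓ, a x - t| ≤ ε + M * (d * K / ℓ) := by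
  have hN := boxVol_pos d ℓ
  have e : (boxVol d ℓ : ℝ)⁻¹ * ∑ x ∈ box d ℓ, a x - t =
      (boxVol d ℓ : ℝ)⁻¹ * ∑ x ∈ box d ℓ, (a x - t) := by
    rw [Finset.sum_sub_distrib, Finset.sum_const, card_box, nsmul_eq_mul, mul_sub,
      inv_mul_cancel_left₀ hN.ne']
  rw [e, abs_mul, abs_of_pos (inv_pos.2 hN), inv_mul_le_iff₀ hN]
  refine (Finset.abs_sum_le_sum_abs _ _).trans ?_
  rw [← Finset.sum_sdiff (box_mono (sub_le_self (ℓ : ℤ) (Int.natCast_nonneg K)))]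
  have s1 : ∑ x ∈ box d ℓ \ box d ((ℓ : ℤ) - K), |a x - t| ≤ boxVol d ℓ * (d * K / ℓ) * M := by
    refine (Finset.sum_le_card_nsmul _ _ M fun x hx => h1 x (Finset.mem_sdiff.1 hx).1).trans ?_
    rw [nsmul_eq_mul]
    exact mul_le_mul_of_nonneg_right (card_boundary_le hd hℓ K) hM
  have s2 : ∑ x ∈ box d ((ℓ : ℤ) - K), |a x - t| ≤ boxVol d ℓ * ε := by
    refine (Finset.sum_le_card_nsmul _ _ ε h2).trans ?_
    rw [nsmul_eq_mul, ← card_box]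
    refine mul_le_mul_of_nonneg_right ?_ hε
    exact_mod_cast Finset.card_le_card (box_mono (sub_le_self (ℓ : ℤ) (Int.natCast_nonneg K)))
  linarith

/-- The neighbours of the origin. -/
noncomputable def unitNbrs (d : ℕ) : Finset (Site d) := (box d 1).filter fun x => Nbr 0 x

theorem mem_unitNbrs {e : Site d} : e ∈ unitNbrs d ↔ Nbr 0 e := by
  unfold unitNbrs
  rw [Finset.mem_filter, and_iff_right_iff_imp, mem_box]
  intro h i
  simpa using nbr_coord h i

theorem card_unitNbrs_le (d : ℕ) : ((unitNbrs d).card : ℝ) ≤ 3 ^ d := by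
  have h : (unitNbrs d).card ≤ 3 ^ d := by
    refine (Finset.card_le_card (Finset.filter_subset _ _)).trans ?_
    have := card_box d 1
    rw [Nat.cast_one] at this
    rw [this, boxVol]
  exact_mod_cast h

theorem sum_bonds_eq {ℓ : ℕ} (x : box d ℓ) (h : Site d → ℝ) :
    (∑ y : box d ℓ, if Nbr x.1 y.1 then h y.1 else 0) =
      ∑ e ∈ unitNbrs d, if x.1 + e ∈ box d ℓ then h (x.1 + e) else 0 := by
  rw [Finset.sum_coe_sort (box d ℓ) (fun y => if Nbr x.1 y then h y else 0), ← Finset.sum_filter,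
    ← Finset.sum_filter]
  have hn : ∀ z : Site d, Nbr x.1 z ↔ Nbr 0 (z - x.1) := by
    intro z
    rw [← nbr_add_right (x := 0) (z := x.1), zero_add, sub_add_cancel]
  refine Finset.sum_nbij' (fun y => y - x.1) (fun e => x.1 + e) ?_ ?_ ?_ ?_ ?_
  · intro y hy
    rw [Finset.mem_filter] at hy ⊢
    rw [mem_unitNbrs, ← hn, add_sub_cancel]
    exact hy.symm
  · intro e he
    rw [Finset.mem_filter] at he ⊢
    rw [hn, add_sub_cancel_left, ← mem_unitNbrs]
    exact he.symm
  · intro y _; exact add_sub_cancel _ _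
  · intro e _; exact add_sub_cancel_left _ _
  · intro y _; rw [add_sub_cancel]

theorem add_mem_box {ℓ : ℤ} {j k : ℤ} {x e : Site d} (hx : x ∈ box d j) (he : e ∈ box d k)
    (h : j + k ≤ ℓ) : x + e ∈ box d ℓ := by
  rw [mem_box] at *
  intro i
  exact (abs_add_le _ _).trans ((add_le_add (hx i) (he i)).trans h)

theorem unitNbrs_subset : unitNbrs d ⊆ box d 1 := Finset.filter_subset _ _

/-- Interior sites have all their neighbours in the box and cost `ε` per direction. Sites in the
boundary layer, where bonds may be missing, cost at most `2M` per direction. There are at most `3^d`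
directions. -/
theorem abs_bond_average_sub_le (hd : 1 ≤ d) {ℓ : ℕ} (hℓ : 1 ≤ ℓ) {K : ℕ} (hK : 1 ≤ K)
    {h : Site d → Site d → ℝ} {t : Site d → ℝ} {M ε : ℝ} (hε : 0 ≤ ε) (hM : 0 ≤ M)
    (hh : ∀ x ∈ box d ℓ, ∀ e ∈ unitNbrs d, x + e ∈ box d ℓ → |h x (x + e)| ≤ M)
    (ht : ∀ e ∈ unitNbrs d, |t e| ≤ M)
    (hi : ∀ x ∈ box d ((ℓ : ℤ) - K), ∀ e ∈ unitNbrs d, |h x (x + e) - t e| ≤ ε) :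
    |(boxVol d ℓ : ℝ)⁻¹ * (∑ x : box d ℓ, ∑ y : box d ℓ, if Nbr x.1 y.1 then h x.1 y.1 else 0) -
        ∑ e ∈ unitNbrs d, t e| ≤ 3 ^ d * (ε + 2 * M * (d * K / ℓ)) := by
  have h1 : (∑ x : box d ℓ, ∑ y : box d ℓ, if Nbr x.1 y.1 then h x.1 y.1 else 0) =
      ∑ x ∈ box d ℓ, ∑ e ∈ unitNbrs d, if x + e ∈ box d ℓ then h x (x + e) else 0 := by
    rw [← Finset.sum_coe_sort (box d ℓ)]
    exact Finset.sum_congr rfl fun x _ => sum_bonds_eq x (h x.1)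
  rw [h1]
  have hcard := card_unitNbrs_le d
  have key := abs_average_sub_le hd hℓ K (t := ∑ e ∈ unitNbrs d, t e)
    (a := fun x => ∑ e ∈ unitNbrs d, if x + e ∈ box d ℓ then h x (x + e) else 0)
    (M := 3 ^ d * (2 * M)) (ε := 3 ^ d * ε) (by positivity) (by positivity) ?_ ?_
  · refine key.trans (le_of_eq ?_); ring
  · intro x hx
    rw [← Finset.sum_sub_distrib]
    refine (Finset.abs_sum_le_sum_abs _ _).trans
      ((Finset.sum_le_card_nsmul _ _ (2 * M) fun e he => ?_).trans ?_)
    · have h2 := ht e he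
      split_ifs with h3
      · have h4 := hh x hx e he h3
        rw [abs_le] at *
        constructor <;> linarith
      · rw [zero_sub, abs_neg]; linarith
    · rw [nsmul_eq_mul]; gcongr
  · intro x hx
    rw [← Finset.sum_sub_distrib]
    refine (Finset.abs_sum_le_sum_abs _ _).trans
      ((Finset.sum_le_card_nsmul _ _ ε fun e he => ?_).trans ?_)
    · rw [if_pos (add_mem_box hx (unitNbrs_subset he) (by omega))]
      exact hi x hx e he
    · rw [nsmul_eq_mul]; gcongr

/-! ### Sums over the unit vectors -/

theorem mem_unitNbrs_iff {e : Site d} :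
    e ∈ unitNbrs d ↔ ∃ i, ∃ s ∈ ({1, -1} : Finset ℤ), e = Pi.single i s := by
  rw [mem_unitNbrs]
  unfold Nbr
  simp only [Pi.zero_apply, zero_sub, abs_neg]
  constructor
  · intro h
    have : ∃ i, e i ≠ 0 := by
      by_contra hcon
      push Not at hcon
      simp [hcon] at h
    obtain ⟨i, hi⟩ := this
    have hsplit := Finset.add_sum_erase Finset.univ (fun i => |e i|) (Finset.mem_univ i)
    have hnn : 0 ≤ ∑ j ∈ Finset.univ.erase i, |e j| := Finset.sum_nonneg fun _ _ => abs_nonneg _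
    have h1 : 1 ≤ |e i| := Int.one_le_abs hi
    have h2 : |e i| = 1 := by omega
    have h3 : ∑ j ∈ Finset.univ.erase i, |e j| = 0 := by omega
    rw [Finset.sum_eq_zero_iff_of_nonneg fun _ _ => abs_nonneg _] at h3
    refine ⟨i, e i, ?_, ?_⟩
    · rcases (abs_eq zero_le_one).1 h2 with h | h <;> simp [h]
    · funext j
      by_cases hj : j = i
      · subst hj; simp
      · rw [Pi.single_eq_of_ne hj]
        exact abs_eq_zero.1 (h3 j (Finset.mem_erase.2 ⟨hj, Finset.mem_univ _⟩))
  · rintro ⟨i, s, hs, rfl⟩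
    rw [Finset.sum_eq_single i]
    · rcases Finset.mem_insert.1 hs with rfl | hs
      · simp
      · rw [Finset.mem_singleton.1 hs]; simp
    · intro j _ hj; simp [hj]
    · simp

theorem sum_unitNbrs (f : Site d → ℝ) :
    ∑ e ∈ unitNbrs d, f e = ∑ i, (f (Pi.single i 1) + f (Pi.single i (-1))) := by
  have h : ∀ i, f (Pi.single i 1) + f (Pi.single i (-1)) =
      ∑ s ∈ ({1, -1} : Finset ℤ), f (Pi.single i s) := fun i => by
    rw [Finset.sum_pair (by norm_num)]
  simp only [h]
  rw [← Finset.sum_product']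
  symm
  refine Finset.sum_bij (fun p _ => Pi.single p.1 p.2) ?_ ?_ ?_ ?_
  · intro p hp
    exact mem_unitNbrs_iff.2 ⟨p.1, p.2, (Finset.mem_product.1 hp).2, rfl⟩
  · rintro ⟨i, s⟩ hp ⟨j, t⟩ hq hpq
    have hs : s ≠ 0 := by
      rcases Finset.mem_insert.1 (Finset.mem_product.1 hp).2 with h | h
      · simp only at h; omega
      · have := Finset.mem_singleton.1 h; simp only at this; omega
    have h1 := congrFun hpq i
    simp only [Pi.single_eq_same] at h1
    have hij : i = j := by
      by_contra hij
      rw [Pi.single_eq_of_ne hij] at h1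
      exact hs h1
    subst hij
    rw [Pi.single_eq_same] at h1
    rw [h1]
  · intro e he
    obtain ⟨i, s, hs, rfl⟩ := mem_unitNbrs_iff.1 he
    exact ⟨(i, s), Finset.mem_product.2 ⟨Finset.mem_univ _, hs⟩, rfl⟩
  · intro _ _; rfl

theorem inner_toVec_single (θ : Vec d) (i : Fin d) (s : ℤ) :
    inner ℝ θ (toVec (Pi.single i s)) = θ i * s := by
  rw [PiLp.inner_apply, Finset.sum_eq_single i]
  · simp [toVec, mul_comm]
  · intro j _ hj; simp [toVec, hj]
  · simp

theorem sum_unitNbrs_inner_mul_inner (θ θ' : Vec d) :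
    ∑ e ∈ unitNbrs d, inner ℝ θ' (toVec e) * inner ℝ θ (toVec e) = 2 * inner ℝ θ θ' := by
  rw [sum_unitNbrs, PiLp.inner_apply, Finset.mul_sum]
  refine Finset.sum_congr rfl fun i _ => ?_
  simp only [inner_toVec_single]
  simp
  ring

theorem sum_unitNbrs_inner (θ : Vec d) : ∑ e ∈ unitNbrs d, inner ℝ θ (toVec e) = 0 := by
  rw [sum_unitNbrs]
  refine Finset.sum_eq_zero fun i _ => ?_
  simp only [inner_toVec_single]
  simp

theorem norm_toVec_of_mem {e : Site d} (he : e ∈ unitNbrs d) : ‖toVec e‖ = 1 := by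
  obtain ⟨i, s, hs, rfl⟩ := mem_unitNbrs_iff.1 he
  have : toVec (Pi.single i s : Site d) = PiLp.single 2 i (s : ℝ) := by
    ext j
    by_cases hj : j = i
    · subst hj; simp [toVec]
    · simp [toVec, hj]
  rw [this, PiLp.norm_single]
  rcases Finset.mem_insert.1 hs with rfl | hs
  · simp
  · rw [Finset.mem_singleton.1 hs]; simp

theorem abs_inner_toVec_le {θ : Vec d} (hθ : ‖θ‖ = 1) {e : Site d} (he : e ∈ unitNbrs d) :
    |inner ℝ θ (toVec e)| ≤ 1 := by
  have := abs_real_inner_le_norm θ (toVec e)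
  rwa [hθ, norm_toVec_of_mem he, mul_one] at this

end Averages

/-! ### Local functions -/

section LocalFunctions

variable {d : ℕ}

theorem LocalFun.norm_le (F : LocalFun d) (η : Config d) : ‖F η‖ ≤ F.supNorm := by
  obtain ⟨B, hB⟩ := exists_bound_of_dependsOn (S := box d F.radius) (f := fun η => ‖F η‖)
    fun _ _ h => congrArg _ (F.radius_spec.2 h)
  refine le_ciSup (f := fun η => ‖F η‖) ⟨B, ?_⟩ η
  rintro _ ⟨η, rfl⟩
  exact (le_abs_self _).trans (hB η)

theorem LocalFun.supNorm_nonneg (F : LocalFun d) : 0 ≤ F.supNorm :=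
  (norm_nonneg _).trans (F.norm_le fun _ => false)

theorem LocalFun.one_le_radius (F : LocalFun d) : (1 : ℝ) ≤ F.radius := by
  exact_mod_cast F.radius_spec.1

theorem LocalFun.sub_mem_box (F : LocalFun d) {x e z : Site d} (he : e ∈ unitNbrs d) {η : Config d}
    (h : F (shift z (exch x (x + e) η)) - F (shift z η) ≠ 0) :
    z - x ∈ box d (F.radius + 1) := by
  have he' := mem_box.1 (unitNbrs_subset he)
  by_contra hz
  apply h
  rw [F.shift_exch_of_notMem, sub_self]
  · contrapose! hz
    rw [mem_box] at *
    intro i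
    have := hz i
    simp only [Pi.sub_apply, abs_le] at *
    omega
  · contrapose! hz
    rw [mem_box] at *
    intro i
    have h1 := hz i
    have h2 := he' i
    simp only [Pi.sub_apply, Pi.add_apply, abs_le] at *
    omega

theorem exchFormalSum_eq_sum (F : LocalFun d) {e : Site d} (he : e ∈ unitNbrs d)
    {T : Finset (Site d)} (hT : box d (F.radius + 1) ⊆ T) (η : Config d) :
    exchFormalSum F e η = ∑ y ∈ T, (F (shift y (exch 0 e η)) - F (shift y η)) := by
  refine finsum_eq_sum_of_support_subset _ fun y hy => hT ?_
  have := F.sub_mem_box (x := 0) he (η := η) (z := y) (by simpa using hy)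
  simpa using this

/-- Only the translates centred in `x + Λ(r(F) + 1)` feel the exchange, at most `(2r(F) + 3)^d ≤
(5r(F))^d` of them, so the bound is uniform in `T`. This is where `⦀F⦀_{0,∞}` enters. -/
theorem LocalFun.abs_sum_inner_exch_le (F : LocalFun d) {x e : Site d} (he : e ∈ unitNbrs d)
    (T : Finset (Site d)) (η : Config d) {θ : Vec d} (hθ : ‖θ‖ = 1) :
    |∑ z ∈ T, inner ℝ θ (F (shift z (exch x (x + e) η)) - F (shift z η))| ≤
      2 * 5 ^ d * F.tripleNorm := by
  have hF := F.supNorm_nonneg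
  have hcard : ((T.filter fun z => z - x ∈ box d (F.radius + 1)).card : ℝ) ≤
      5 ^ d * (F.radius : ℝ) ^ d := by
    have h1 : (T.filter fun z => z - x ∈ box d (F.radius + 1)).card ≤
        (box d (F.radius + 1)).card :=
      Finset.card_le_card_of_injOn (fun z => z - x) (fun z hz => (Finset.mem_filter.1 hz).2)
        fun a _ b _ h => sub_left_injective h
    have h2 : (box d (F.radius + 1)).card ≤ (5 * F.radius) ^ d := by
      have := card_box d (F.radius + 1)
      rw [Nat.cast_add, Nat.cast_one] at this
      rw [this, boxVol]
      have := F.radius_spec.1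
      gcongr; omega
    rw [← mul_pow]
    exact_mod_cast h1.trans h2
  rw [← Finset.sum_filter_of_ne (p := fun z => z - x ∈ box d (F.radius + 1))]
  · refine (Finset.abs_sum_le_sum_abs _ _).trans
      ((Finset.sum_le_card_nsmul _ _ (2 * F.supNorm) fun z _ => ?_).trans ?_)
    · have h1 := abs_real_inner_le_norm θ (F (shift z (exch x (x + e) η)) - F (shift z η))
      have h2 := norm_sub_le (F (shift z (exch x (x + e) η))) (F (shift z η))
      rw [hθ, one_mul] at h1
      linarith [F.norm_le (shift z (exch x (x + e) η)), F.norm_le (shift z η)]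
    · rw [nsmul_eq_mul, LocalFun.tripleNorm]
      nlinarith
  · intro z _ hz
    refine F.sub_mem_box he (η := η) fun h => hz ?_
    rw [h, inner_zero_right]

/-- By homogeneity it suffices to bound the rates of the finitely many bonds at the origin, each of
which takes finitely many values. -/
theorem Rates.exists_bound (c : Rates d) :
    ∃ B : ℝ, 0 < B ∧ ∀ x y η, Nbr x y → c.rate x y η ≤ B := by
  obtain ⟨R, hR⟩ := c.isLocal
  have h : ∀ e : Site d, ∃ B, Nbr 0 e → ∀ η, |c.rate 0 e η| ≤ B := by
    intro e
    by_cases he : Nbr 0 e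
    · obtain ⟨B, hB⟩ := exists_bound_of_dependsOn (S := box d R) ((hR 0 e he).mono fun z hz => by
        rw [Finset.mem_coe, mem_box]
        simpa using hz)
      exact ⟨B, fun _ => hB⟩
    · exact ⟨0, fun h => absurd h he⟩
  choose B hB using h
  refine ⟨1 + ∑ e ∈ unitNbrs d, |B e|, by positivity, fun x y η hxy => ?_⟩
  rw [c.homogeneous x y η hxy]
  have hn : Nbr 0 (y - x) := by
    rw [← nbr_add_right (z := x), zero_add, sub_add_cancel]; exact hxy
  have h1 := Finset.single_le_sum (f := fun e => |B e|) (fun _ _ => abs_nonneg _)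
    (mem_unitNbrs.2 hn)
  have h2 := hB _ hn (shift x η)
  have h3 := le_abs_self (B (y - x))
  have h4 := le_abs_self (c.rate 0 (y - x) (shift x η))
  linarith

theorem integral_comp_shift (ρ : unitInterval) (x : Site d) {S : Finset (Site d)}
    {f : Config d → ℝ} (hf : DependsOn f (S : Set (Site d))) :
    ∫ η, f (shift x η) ∂bernoulliProd d ρ = ∫ η, f η ∂bernoulliProd d ρ := by
  have hmeas : Measurable (shift x : Config d → Config d) :=
    measurable_pi_lambda _ fun y => measurable_pi_apply _
  have hmap : (bernoulliProd d ρ).map (shift x) = bernoulliProd d ρ := by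
    have h := Measure.infinitePi_map_piCongrLeft
      (μ := fun _ : Site d => bernoulliMeasure true false ρ) (Equiv.addRight x).symm
    have e : ⇑(MeasurableEquiv.piCongrLeft (fun _ : Site d => Bool) (Equiv.addRight x).symm) =
        (shift x : Config d → Config d) := by
      funext η y
      obtain ⟨z, rfl⟩ := (Equiv.addRight x).symm.surjective y
      rw [MeasurableEquiv.coe_piCongrLeft, Equiv.piCongrLeft_apply_apply]
      simp [shift]
    rw [e] at h
    exact h
  conv_rhs => rw [← hmap]
  rw [integral_map hmeas.aemeasurable (measurable_of_dependsOn hf).aestronglyMeasurable]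

theorem shift_shift (x y : Site d) (η : Config d) : shift y (shift x η) = shift (y + x) η := by
  funext w; simp [shift, add_assoc]

/-! ### The diffusion coefficient as a limit of variances -/

/-- The local function whose mean is the contribution of the bond `{0, e}` to `θ · ĉ(ρ;F) θ`. -/
noncomputable def bondForm (c : Rates d) (F : LocalFun d) (θ : Vec d) (e : Site d)
    (η : Config d) : ℝ :=
  c.rate 0 e η *
    (inner ℝ θ ((occ (η e) - occ (η 0)) • toVec e - exchFormalSum F e η)) ^ 2

theorem conductivityForm_eq (c : Rates d) (ρ : unitInterval) (F : LocalFun d) (θ : Vec d) :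
    conductivityForm c ρ F θ =
      (1 / 2) * ∑ e ∈ unitNbrs d, ∫ η, bondForm c F θ e η ∂bernoulliProd d ρ := rfl

theorem abs_occ_sub_le (a b : Bool) : |occ a - occ b| ≤ 1 := by
  cases a <;> cases b <;> simp [occ]

theorem abs_rate_mul_sq_le {c : Rates d} {B : ℝ} (hB : ∀ x y η, Nbr x y → c.rate x y η ≤ B)
    {x y : Site d} (h : Nbr x y) (η : Config d) {s t T : ℝ} (hs : |s| ≤ 1)
    (ht : |t| ≤ 2 * 5 ^ d * T) :
    |c.rate x y η * (s - t) ^ 2| ≤ 8 * 25 ^ d * B * (1 + T ^ 2) := by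
  have hc := c.pos x y η h
  have hcB := hB x y η h
  rw [abs_of_nonneg (by positivity)]
  have h1 : (s - t) ^ 2 ≤ 2 * (1 + (2 * 5 ^ d * T) ^ 2) := by
    have h2 : s ^ 2 ≤ 1 := by rw [sq_le_one_iff_abs_le_one]; exact hs
    have h3 : t ^ 2 ≤ (2 * 5 ^ d * T) ^ 2 := sq_le_sq' (abs_le.1 ht).1 (abs_le.1 ht).2
    nlinarith [sq_nonneg (s + t)]
  have h4 : (2 * 5 ^ d * T : ℝ) ^ 2 = 4 * 25 ^ d * T ^ 2 := by
    rw [mul_pow, mul_pow, ← pow_mul, mul_comm d 2, pow_mul]; norm_num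
  have h5 : (1 : ℝ) ≤ 25 ^ d := one_le_pow₀ (by norm_num)
  have h6 : (s - t) ^ 2 ≤ 8 * 25 ^ d * (1 + T ^ 2) := by
    rw [h4] at h1
    nlinarith
  calc c.rate x y η * (s - t) ^ 2 ≤ B * (8 * 25 ^ d * (1 + T ^ 2)) := by
        gcongr
        exact hc.le.trans hcB
    _ = _ := by ring

theorem abs_bondForm_le {c : Rates d} {B : ℝ} (hB : ∀ x y η, Nbr x y → c.rate x y η ≤ B)
    (F : LocalFun d) {θ : Vec d} (hθ : ‖θ‖ = 1) {e : Site d} (he : e ∈ unitNbrs d)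
    (η : Config d) : |bondForm c F θ e η| ≤ 8 * 25 ^ d * B * (1 + F.tripleNorm ^ 2) := by
  unfold bondForm
  rw [inner_sub_right]
  refine abs_rate_mul_sq_le hB (mem_unitNbrs.1 he) η ?_ ?_
  · rw [inner_smul_right, abs_mul]
    exact mul_le_one₀ (abs_occ_sub_le _ _) (abs_nonneg _) (abs_inner_toVec_le hθ he)
  · rw [exchFormalSum_eq_sum F he le_rfl, inner_sum]
    have := F.abs_sum_inner_exch_le (x := 0) he (box d (F.radius + 1)) η hθ
    rwa [zero_add] at this

/-- Translates centred in `Λ(r(F) + 1)` read sites of `Λ(2r(F) + 1)`; the rate reads sites of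
`Λ(R)`. -/
theorem dependsOn_bondForm {c : Rates d} {R : ℕ}
    (hR : ∀ x y, Nbr x y → DependsOn (c.rate x y) {z | ∀ i, |z i - x i| ≤ (R : ℤ)})
    (F : LocalFun d) (θ : Vec d) {e : Site d} (he : e ∈ unitNbrs d) :
    DependsOn (bondForm c F θ e) (box d ((2 * F.radius + 1 + R : ℕ) : ℤ) : Set (Site d)) := by
  intro η η' h
  have he1 := unitNbrs_subset he
  have hmem : ∀ z ∈ box d (2 * F.radius + 1), η z = η' z := fun z hz =>
    h z (box_mono (by push_cast; omega) hz)
  have h0 : (0 : Site d) ∈ box d (2 * F.radius + 1) := by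
    rw [mem_box]; intro i; simp only [Pi.zero_apply, abs_zero]; omega
  have heb : e ∈ box d (2 * F.radius + 1) := box_mono (by omega) he1
  have hswap : ∀ z ∈ box d (2 * F.radius + 1), exch 0 e η z = exch 0 e η' z := by
    intro z hz
    unfold exch
    apply hmem
    rw [Equiv.swap_apply_def]
    split_ifs
    · exact heb
    · exact h0
    · exact hz
  have hrate : c.rate 0 e η = c.rate 0 e η' := by
    refine hR 0 e (mem_unitNbrs.1 he) fun z hz => h z ?_
    rw [Finset.mem_coe, mem_box]
    intro i
    have := hz i
    rw [Pi.zero_apply, sub_zero] at this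
    push_cast
    omega
  have hsum : exchFormalSum F e η = exchFormalSum F e η' := by
    rw [exchFormalSum_eq_sum F he le_rfl, exchFormalSum_eq_sum F he le_rfl]
    refine Finset.sum_congr rfl fun y hy => ?_
    have hadd : ∀ w ∈ (box d F.radius : Set (Site d)), w + y ∈ box d (2 * F.radius + 1) :=
      fun w hw => add_mem_box hw hy (by omega)
    congr 1
    · exact F.radius_spec.2 fun w hw => hswap _ (hadd w hw)
    · exact F.radius_spec.2 fun w hw => hmem _ (hadd w hw)
  unfold bondForm
  rw [hrate, hsum, hmem e heb, hmem 0 h0]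

variable {ℓ m : ℕ}

/-- `⟨c_{x,y} (π_{x,y} u)²⟩`, where `u` is the potential of the current. -/
noncomputable def bondEnergy (c : Rates d) (F : LocalFun d) (ℓ m : ℕ) (θ : Vec d)
    (ζ : {x : Site d // x ∉ box d ℓ} → Bool) (x y : Site d) : ℝ :=
  canonMean fun ξ : CanonConfig d ℓ m => c.rate x y (glue ξ.1 ζ) *
    ((occ (glue ξ.1 ζ y) - occ (glue ξ.1 ζ x)) * inner ℝ θ (toVec (y - x)) -
      ∑ z ∈ box d ((ℓ : ℤ) - (F.radius + 1)),
        inner ℝ θ (F (shift z (exch x y (glue ξ.1 ζ))) - F (shift z (glue ξ.1 ζ)))) ^ 2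

/-- Since the current is `-L u`, the variance is `⟨u (-L) u⟩`, that is, the Dirichlet form of `u`.
The factor `1/4` combines the `1/2` of the form with the double counting of bonds. -/
theorem cltVar_current_eq (c : Rates d) (F : LocalFun d) (θ : Vec d)
    (ζ : {x : Site d // x ∉ box d ℓ} → Bool) :
    cltVar c ζ (currentBHMeanZero d ℓ m c F ζ θ) (currentBHMeanZero d ℓ m c F ζ θ) =
      (1 / 4) * ∑ x : box d ℓ, ∑ y : box d ℓ,
        if Nbr x.1 y.1 then bondEnergy c F ℓ m θ ζ x y else 0 := by
  obtain ⟨w, hw⟩ : ∃ w : CanonConfig d ℓ m → ℝ, w = fun ξ =>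
      moment ℓ θ (glue ξ.1 ζ) + corrector ℓ θ F (glue ξ.1 ζ) := ⟨_, rfl⟩
  have hg : ∀ ξ, -localGen c ζ w ξ = (currentBHMeanZero d ℓ m c F ζ θ).1 ξ := by
    rw [hw]; exact neg_localGen_potential c F ζ θ
  rw [cltVar_eq_canonMean c ζ _ _ w hg]
  simp only [← hg]
  have h1 : ∑ ξ, -localGen c ζ w ξ * w ξ = -∑ ξ, w ξ * localGen c ζ w ξ := by
    rw [← Finset.sum_neg_distrib]
    exact Finset.sum_congr rfl fun _ _ => by ring
  rw [canonMean, h1, sum_mul_localGen]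
  have h2 : ∀ x y : box d ℓ, (∑ ξ : CanonConfig d ℓ m, if Nbr x.1 y.1 then
      c.rate x y (glue ξ.1 ζ) * (w (canonExch x y ξ) - w ξ) ^ 2 else 0) /
      Fintype.card (CanonConfig d ℓ m) =
      if Nbr x.1 y.1 then bondEnergy c F ℓ m θ ζ x y else 0 := by
    intro x y
    split_ifs
    · unfold bondEnergy canonMean
      refine congrArg (· / _) (Finset.sum_congr rfl fun ξ _ => ?_)
      have e : w (canonExch x y ξ) - w ξ =
          -((occ (glue ξ.1 ζ y) - occ (glue ξ.1 ζ x)) * inner ℝ θ (toVec (y.1 - x.1)) -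
      ∑ z ∈ box d ((ℓ : ℤ) - (F.radius + 1)),
        inner ℝ θ (F (shift z (exch x y (glue ξ.1 ζ))) - F (shift z (glue ξ.1 ζ)))) := by
        have hm := moment_exch θ x.2 y.2 (glue ξ.1 ζ)
        simp only [hw, glue_canonExch, corrector, inner_sub_right, Finset.sum_sub_distrib]
        linear_combination hm
      rw [e, neg_sq]
    · simp
  simp only [← h2]
  simp only [← Finset.sum_div]
  ring

theorem abs_bondEnergy_le {c : Rates d} {B : ℝ} (hB0 : 0 < B)
    (hB : ∀ x y η, Nbr x y → c.rate x y η ≤ B)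
    (F : LocalFun d) {θ : Vec d} (hθ : ‖θ‖ = 1) (ζ : {x : Site d // x ∉ box d ℓ} → Bool)
    (x : Site d) {e : Site d} (he : e ∈ unitNbrs d) :
    |bondEnergy c F ℓ m θ ζ x (x + e)| ≤ 8 * 25 ^ d * B * (1 + F.tripleNorm ^ 2) := by
  refine abs_canonMean_le (by positivity) fun ξ => ?_
  have hn : Nbr x (x + e) := by
    have := (nbr_add_right (z := x)).2 (mem_unitNbrs.1 he)
    rwa [zero_add, add_comm] at this
  refine abs_rate_mul_sq_le hB hn _ ?_ (F.abs_sum_inner_exch_le he _ _ hθ)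
  rw [abs_mul, add_sub_cancel_left]
  exact mul_le_one₀ (abs_occ_sub_le _ _) (abs_nonneg _) (abs_inner_toVec_le hθ he)

/-- For `x` at depth `2r(F) + 2`, every centre whose translate feels the bond at `x` lies in `Λ(ℓ -
r(F) - 1)`. The truncated sum in the corrector then acts like the full sum over `ℤ^d`. -/
theorem bondEnergy_eq_of_interior (c : Rates d) (F : LocalFun d) (θ : Vec d)
    (ζ : {x : Site d // x ∉ box d ℓ} → Bool) {x e : Site d} {K : ℤ} (hK : 2 * F.radius + 2 ≤ K)
    (hx : x ∈ box d (ℓ - K)) (he : e ∈ unitNbrs d) :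
    bondEnergy c F ℓ m θ ζ x (x + e) =
      canonMean fun ξ : CanonConfig d ℓ m => bondForm c F θ e (shift x (glue ξ.1 ζ)) := by
  unfold bondEnergy
  congr 1
  funext ξ
  set η := glue ξ.1 ζ
  have hrate : c.rate x (x + e) η = c.rate 0 e (shift x η) := by
    rw [rate_shift c (mem_unitNbrs.1 he), zero_add, add_comm]
  have hsum : exchFormalSum F e (shift x η) = ∑ z ∈ box d ((ℓ : ℤ) - (F.radius + 1)),
      (F (shift z (exch x (x + e) η)) - F (shift z η)) := by
    rw [exchFormalSum_eq_sum F he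
      (T := (box d ((ℓ : ℤ) - (F.radius + 1))).map (Equiv.subRight x).toEmbedding),
      Finset.sum_map]
    · refine Finset.sum_congr rfl fun z _ => ?_
      have : exch 0 e (shift x η) = shift x (exch x (x + e) η) := by
        have := shift_exch x 0 e η
        rw [← this, zero_add, add_comm]
      simp [this, shift_shift]
    · intro y hy
      rw [Finset.mem_map]
      exact ⟨y + x, add_mem_box hy hx (by omega), by simp⟩
  unfold bondForm
  rw [hrate, hsum, inner_sub_right, inner_smul_right, inner_sum, add_sub_cancel_left]
  simp [shift, add_comm]

theorem abs_bondEnergy_sub_integral_le {c : Rates d} {B : ℝ} {R : ℕ}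
    (hB : ∀ x y η, Nbr x y → c.rate x y η ≤ B)
    (hR : ∀ x y, Nbr x y → DependsOn (c.rate x y) {z | ∀ i, |z i - x i| ≤ (R : ℤ)})
    (F : LocalFun d) {θ : Vec d} (hθ : ‖θ‖ = 1) (hm : m ≤ boxVol d ℓ)
    (ζ : {x : Site d // x ∉ box d ℓ} → Bool) {x e : Site d}
    (hx : x ∈ box d ((ℓ : ℤ) - ((2 * F.radius + 2 + R : ℕ) : ℤ))) (he : e ∈ unitNbrs d) :
    |bondEnergy c F ℓ m θ ζ x (x + e) -
        ∫ η, bondForm c F θ e η ∂bernoulliProd d (density hm)| ≤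
      5 * (8 * 25 ^ d * B * (1 + F.tripleNorm ^ 2)) * boxVol d (2 * F.radius + 1 + R) /
        boxVol d ℓ := by
  have hdep := dependsOn_bondForm hR F θ he
  set S := (box d ((2 * F.radius + 1 + R : ℕ) : ℤ)).map (Equiv.addRight x).toEmbedding with hS
  have hdepS : DependsOn (fun η => bondForm c F θ e (shift x η)) (S : Set (Site d)) := by
    intro η η' h
    refine hdep fun z hz => h (z + x) ?_
    rw [Finset.mem_coe, hS, Finset.mem_map]
    exact ⟨z, hz, rfl⟩
  have hSb : S ⊆ box d ℓ := by
    intro y hy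
    obtain ⟨z, hz, rfl⟩ := Finset.mem_map.1 hy
    exact add_mem_box hz hx (by push_cast; omega)
  rw [bondEnergy_eq_of_interior c F θ ζ (K := ((2 * F.radius + 2 + R : ℕ) : ℤ))
    (by push_cast; omega) hx he, canonMean_glue ζ (hdepS.mono (by exact_mod_cast hSb)),
    ← integral_comp_shift (density hm) x hdep]
  have := abs_urnMean_sub_integral_le (m := m) (density hm) (U := box d ℓ) (by rw [card_box]; rfl)
    hSb (by rw [card_box]; exact hm) hdepS fun η => abs_bondForm_le hB F hθ he (shift x η)
  rwa [hS, Finset.card_map, card_box, card_box] at this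

theorem exists_errQ4_bound (hd : 1 ≤ d) (c : Rates d) :
    ∃ C : ℝ, 0 < C ∧ ∀ (F : LocalFun d) (ℓ : ℕ), 1 ≤ ℓ → ∀ θ : Vec d, ‖θ‖ = 1 →
      ∀ (m : ℕ) (hm : m ≤ boxVol d ℓ) (ζ : {x : Site d // x ∉ box d ℓ} → Bool),
        |errQ4 c F ℓ θ hm ζ| ≤ C * (F.radius : ℝ) ^ d * (1 + F.tripleNorm ^ 2) * (ℓ : ℝ)⁻¹ := by
  obtain ⟨B, hB0, hB⟩ := c.exists_bound
  obtain ⟨R, hR⟩ := c.isLocal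
  -- `3^d` bounds the number of directions and `8·25^d·B` comes from the sup bound on `bondForm`. In
  -- the last factor, the first term is the equivalence of ensembles and the second is the boundary
  -- layer of width `2r(F) + 2 + R ≤ (4 + R) r(F)^d`.
  refine ⟨3 ^ d * (8 * 25 ^ d * B) * (5 * (2 * R + 7) ^ d + 2 * d * (4 + R)), by positivity,
    fun F ℓ hℓ θ hθ m hm ζ => ?_⟩
  have hℓ0 : (0 : ℝ) < ℓ := by exact_mod_cast hℓ
  have hr := F.one_le_radius
  set r : ℝ := (F.radius : ℝ) with hrdef
  set M : ℝ := 8 * 25 ^ d * B * (1 + F.tripleNorm ^ 2) with hM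
  have hM0 : 0 ≤ M := by positivity
  have hrd : r ≤ r ^ d := le_self_pow₀ hr (by omega)
  have hε : ∀ x ∈ box d ((ℓ : ℤ) - ((2 * F.radius + 2 + R : ℕ) : ℤ)), ∀ e ∈ unitNbrs d,
      |bondEnergy c F ℓ m θ ζ x (x + e) -
        ∫ η, bondForm c F θ e η ∂bernoulliProd d (density hm)| ≤
        5 * M * ((2 * R + 7) ^ d * r ^ d) / ℓ := by
    intro x hx e he
    refine (abs_bondEnergy_sub_integral_le hB hR F hθ hm ζ hx he).trans ?_
    have h1 : (boxVol d (2 * F.radius + 1 + R) : ℝ) ≤ (2 * R + 7) ^ d * r ^ d := by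
      unfold boxVol
      rw [← mul_pow]
      push_cast
      gcongr
      have : (0 : ℝ) ≤ R := by positivity
      nlinarith
    have h2 := le_boxVol hd ℓ
    gcongr
  have key := abs_bond_average_sub_le hd hℓ (K := 2 * F.radius + 2 + R) (by omega)
    (h := bondEnergy c F ℓ m θ ζ)
    (t := fun e => ∫ η, bondForm c F θ e η ∂bernoulliProd d (density hm))
    (M := M) (ε := 5 * M * ((2 * R + 7) ^ d * r ^ d) / ℓ) (by positivity) hM0
    (fun x _ e he _ => abs_bondEnergy_le hB0 hB F hθ ζ x he)
    (fun e he => by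
      have := norm_integral_le_of_norm_le_const (μ := bernoulliProd d (density hm))
        (f := bondForm c F θ e) (Filter.Eventually.of_forall (abs_bondForm_le hB F hθ he))
      simpa using this) hε
  have herr : errQ4 c F ℓ θ hm ζ = (1 / 4) * ((boxVol d ℓ : ℝ)⁻¹ *
      (∑ x : box d ℓ, ∑ y : box d ℓ, if Nbr x.1 y.1 then bondEnergy c F ℓ m θ ζ x y else 0) -
        ∑ e ∈ unitNbrs d, ∫ η, bondForm c F θ e η ∂bernoulliProd d (density hm)) := by
    unfold errQ4
    rw [cltVar_current_eq, conductivityForm_eq]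
    ring
  rw [herr, abs_mul, abs_of_pos (by norm_num : (0 : ℝ) < 1 / 4)]
  have h3 : (((2 * F.radius + 2 + R : ℕ) : ℝ)) ≤ (4 + R) * r ^ d := by
    push_cast
    have : (0 : ℝ) ≤ R := by positivity
    nlinarith
  have h4 : 3 ^ d * (5 * M * ((2 * R + 7) ^ d * r ^ d) / ℓ +
      2 * M * (d * ((2 * F.radius + 2 + R : ℕ) : ℝ) / ℓ)) ≤
      3 ^ d * (5 * M * ((2 * R + 7) ^ d * r ^ d) / ℓ + 2 * M * (d * ((4 + R) * r ^ d) / ℓ)) := by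
    gcongr
  have h5 := abs_nonneg ((boxVol d ℓ : ℝ)⁻¹ *
      (∑ x : box d ℓ, ∑ y : box d ℓ, if Nbr x.1 y.1 then bondEnergy c F ℓ m θ ζ x y else 0) -
        ∑ e ∈ unitNbrs d, ∫ η, bondForm c F θ e η ∂bernoulliProd d (density hm))
  have h6 : 3 ^ d * (8 * 25 ^ d * B) * (5 * (2 * R + 7) ^ d + 2 * d * (4 + R)) * r ^ d *
      (1 + F.tripleNorm ^ 2) * (ℓ : ℝ)⁻¹ =
      3 ^ d * (5 * M * ((2 * R + 7) ^ d * r ^ d) / ℓ + 2 * M * (d * ((4 + R) * r ^ d) / ℓ)) := by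
    rw [hM]; field_simp
  rw [h6]
  linarith

end LocalFunctions

/-! ### The covariance of the gradient and the current -/

section Gradient

variable {d ℓ m : ℕ}

theorem gradA_eq (θ : Vec d) (ζ : {x : Site d // x ∉ box d ℓ} → Bool) (ξ : CanonConfig d ℓ m) :
    (gradAMeanZero d ℓ m θ).1 ξ = (1 / 2) * ∑ x : box d ℓ, ∑ y : box d ℓ,
      if Nbr x.1 y.1 then
        inner ℝ θ (toVec (y.1 - x.1)) * (occ (glue ξ.1 ζ y) - occ (glue ξ.1 ζ x)) else 0 := by
  change inner ℝ θ (gradA ξ.1) = _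
  simp only [gradA, inner_smul_right, inner_sum]
  congr 1
  refine Finset.sum_congr rfl fun x _ => Finset.sum_congr rfl fun y _ => ?_
  split_ifs
  · rw [inner_smul_right, glue_apply, glue_apply, mul_comm]
  · simp

theorem canonMean_gradA_mul (θ : Vec d) (ζ : {x : Site d // x ∉ box d ℓ} → Bool)
    (f : CanonConfig d ℓ m → ℝ) :
    canonMean (fun ξ => (gradAMeanZero d ℓ m θ).1 ξ * f ξ) =
      (1 / 2) * ∑ x : box d ℓ, ∑ y : box d ℓ, if Nbr x.1 y.1 then
        inner ℝ θ (toVec (y.1 - x.1)) *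
          canonMean (fun ξ => (occ (glue ξ.1 ζ y) - occ (glue ξ.1 ζ x)) * f ξ) else 0 := by
  simp only [gradA_eq θ ζ, mul_assoc, Finset.sum_mul]
  rw [canonMean_mul_left, canonMean_sum]
  congr 1
  refine Finset.sum_congr rfl fun x _ => ?_
  rw [canonMean_sum]
  refine Finset.sum_congr rfl fun y _ => ?_
  split_ifs
  · simp only [mul_assoc]
    rw [canonMean_mul_left]
  · simp [canonMean]

/-- Summation by parts. After subtracting `κ` from `g`, the outer layer contributes nothing, and at
an interior site the unit vectors cancel in pairs. -/
theorem sum_bonds_gradient_eq_zero (θ : Vec d) {g : Site d → ℝ} {κ : ℝ}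
    (hg : ∀ x ∈ box d ℓ, x ∉ box d ((ℓ : ℤ) - 1) → g x = κ) :
    (∑ x : box d ℓ, ∑ y : box d ℓ, if Nbr x.1 y.1 then
      inner ℝ θ (toVec (y.1 - x.1)) * (g y - g x) else 0) = 0 := by
  have h1 : (∑ x : box d ℓ, ∑ y : box d ℓ, if Nbr x.1 y.1 then
      inner ℝ θ (toVec (y.1 - x.1)) * (g x - κ) else 0) = 0 := by
    refine Finset.sum_eq_zero fun x _ => ?_
    by_cases hx : x.1 ∈ box d ((ℓ : ℤ) - 1)
    · rw [sum_bonds_eq x fun y => inner ℝ θ (toVec (y - x.1)) * (g x - κ)]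
      rw [Finset.sum_congr rfl fun e he => by
        rw [if_pos (add_mem_box hx (unitNbrs_subset he) (by omega)), add_sub_cancel_left],
        ← Finset.sum_mul, sum_unitNbrs_inner, zero_mul]
    · simp [hg x x.2 hx]
  have h2 : (∑ x : box d ℓ, ∑ y : box d ℓ, if Nbr x.1 y.1 then
      inner ℝ θ (toVec (y.1 - x.1)) * (g y - κ) else 0) = 0 := by
    rw [Finset.sum_comm]
    refine Eq.trans ?_ (neg_eq_zero.2 h1)
    rw [← Finset.sum_neg_distrib]
    refine Finset.sum_congr rfl fun x _ => ?_
    rw [← Finset.sum_neg_distrib]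
    refine Finset.sum_congr rfl fun y _ => ?_
    by_cases h : Nbr x.1 y.1
    · rw [if_pos h, if_pos h.symm, ← neg_sub y.1 x.1, toVec_neg, inner_neg_right]; ring
    · rw [if_neg h, if_neg fun h' => h h'.symm, neg_zero]
  refine Eq.trans ?_ ((congrArg₂ _ h2 h1).trans (sub_zero (0 : ℝ)))
  rw [← Finset.sum_sub_distrib]
  refine Finset.sum_congr rfl fun x _ => ?_
  rw [← Finset.sum_sub_distrib]
  refine Finset.sum_congr rfl fun y _ => ?_
  split_ifs <;> ring

/-- By exchangeability, the gradient is uncorrelated with functions supported off the boundary. -/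
theorem canonMean_gradA_mul_eq_zero (θ : Vec d) (ζ : {x : Site d // x ∉ box d ℓ} → Bool)
    {f : Config d → ℝ} (hf : DependsOn f (box d ((ℓ : ℤ) - 1) : Set (Site d))) :
    canonMean (fun ξ => (gradAMeanZero d ℓ m θ).1 ξ * f (glue ξ.1 ζ)) = 0 := by
  let g : Site d → ℝ := fun x =>
    canonMean fun ξ : CanonConfig d ℓ m => occ (glue ξ.1 ζ x) * f (glue ξ.1 ζ)
  have hsub : ∀ x y : Site d, canonMean (fun ξ : CanonConfig d ℓ m =>
      (occ (glue ξ.1 ζ y) - occ (glue ξ.1 ζ x)) * f (glue ξ.1 ζ)) = g y - g x := by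
    intro x y
    simp only [g, canonMean, sub_mul, Finset.sum_sub_distrib, sub_div]
  -- Exchanging two sites of the outer layer preserves the canonical measure and leaves `f`
  -- unchanged.
  have hconst : ∀ x ∈ box d ℓ, x ∉ box d ((ℓ : ℤ) - 1) → ∀ y ∈ box d ℓ,
      y ∉ box d ((ℓ : ℤ) - 1) → g x = g y := by
    intro x hx hx' y hy hy'
    have h := canonMean_comp_canonExch ⟨x, hx⟩ ⟨y, hy⟩
      (fun ξ : CanonConfig d ℓ m => occ (glue ξ.1 ζ x) * f (glue ξ.1 ζ))
    change canonMean _ = g x at h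
    rw [← h]
    change _ = canonMean _
    congr 1
    funext ξ
    rw [glue_canonExch, exch_left]
    congr 1
    refine hf fun z hz => exch_other ?_ ?_ _
    · rintro rfl; exact hx' hz
    · rintro rfl; exact hy' hz
  obtain ⟨κ, hκ⟩ : ∃ κ, ∀ x ∈ box d ℓ, x ∉ box d ((ℓ : ℤ) - 1) → g x = κ := by
    by_cases h : ∃ y ∈ box d ℓ, y ∉ box d ((ℓ : ℤ) - 1)
    · obtain ⟨y, hy, hy'⟩ := h
      exact ⟨g y, fun x hx hx' => hconst x hx hx' y hy hy'⟩
    · push Not at h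
      exact ⟨0, fun x hx hx' => absurd (h x hx) hx'⟩
  rw [canonMean_gradA_mul θ ζ]
  simp only [hsub]
  rw [sum_bonds_gradient_eq_zero θ hκ, mul_zero]

theorem canonMean_gradA_mul_corrector (θ θ' : Vec d) (F : LocalFun d)
    (ζ : {x : Site d // x ∉ box d ℓ} → Bool) :
    canonMean (fun ξ : CanonConfig d ℓ m =>
      (gradAMeanZero d ℓ m θ').1 ξ * corrector ℓ θ F (glue ξ.1 ζ)) = 0 := by
  simp only [corrector, Finset.mul_sum]
  rw [canonMean_sum]
  refine Finset.sum_eq_zero fun z hz =>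
    canonMean_gradA_mul_eq_zero θ' ζ (f := fun η => inner ℝ θ (F (shift z η))) ?_
  intro η η' h
  have : F (shift z η) = F (shift z η') :=
    F.radius_spec.2 fun w hw => h _ (add_mem_box hw hz (by omega))
  simp only [this]

/-- The canonical mean of the squared gradient across a pair of sites. -/
noncomputable def gradSq (ℓ m : ℕ) (ζ : {x : Site d // x ∉ box d ℓ} → Bool) (x y : Site d) : ℝ :=
  canonMean fun ξ : CanonConfig d ℓ m => (occ (glue ξ.1 ζ y) - occ (glue ξ.1 ζ x)) ^ 2

/-- The exchange of `x` and `y` flips the sign of the gradient and changes the moment by a multiple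
of that gradient. By invariance the mean `I` satisfies `I = -I + (θ·(y - x)) ⟨(η_y - η_x)²⟩`. -/
theorem canonMean_gradient_mul_moment (θ : Vec d) (ζ : {x : Site d // x ∉ box d ℓ} → Bool)
    (x y : box d ℓ) :
    canonMean (fun ξ : CanonConfig d ℓ m => (occ (glue ξ.1 ζ y) - occ (glue ξ.1 ζ x)) *
      moment ℓ θ (glue ξ.1 ζ)) =
      (1 / 2) * (inner ℝ θ (toVec (y.1 - x.1)) * gradSq ℓ m ζ x y) := by
  have h := canonMean_comp_canonExch x y (fun ξ : CanonConfig d ℓ m =>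
    (occ (glue ξ.1 ζ y) - occ (glue ξ.1 ζ x)) * moment ℓ θ (glue ξ.1 ζ))
  have e : (fun ξ : CanonConfig d ℓ m => (occ (glue (canonExch x y ξ).1 ζ y) -
      occ (glue (canonExch x y ξ).1 ζ x)) * moment ℓ θ (glue (canonExch x y ξ).1 ζ)) =
      fun ξ => -1 * ((occ (glue ξ.1 ζ y) - occ (glue ξ.1 ζ x)) * moment ℓ θ (glue ξ.1 ζ)) +
        inner ℝ θ (toVec (y.1 - x.1)) * (occ (glue ξ.1 ζ y) - occ (glue ξ.1 ζ x)) ^ 2 := by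
    funext ξ
    have hm := moment_exch θ x.2 y.2 (glue ξ.1 ζ)
    rw [glue_canonExch, exch_left, exch_right]
    linear_combination (occ (glue ξ.1 ζ x) - occ (glue ξ.1 ζ y)) * hm
  rw [e, canonMean_add, canonMean_mul_left, canonMean_mul_left] at h
  unfold gradSq
  linarith

theorem cltVar_gradA_current_eq (c : Rates d) (F : LocalFun d) (θ θ' : Vec d)
    (ζ : {x : Site d // x ∉ box d ℓ} → Bool) :
    cltVar c ζ (gradAMeanZero d ℓ m θ') (currentBHMeanZero d ℓ m c F ζ θ) =
      (1 / 4) * ∑ x : box d ℓ, ∑ y : box d ℓ, if Nbr x.1 y.1 then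
        inner ℝ θ' (toVec (y.1 - x.1)) * inner ℝ θ (toVec (y.1 - x.1)) * gradSq ℓ m ζ x y
        else 0 := by
  rw [cltVar_eq_canonMean c ζ _ _ (fun ξ : CanonConfig d ℓ m =>
    moment ℓ θ (glue ξ.1 ζ) + corrector ℓ θ F (glue ξ.1 ζ)) (neg_localGen_potential c F ζ θ)]
  simp only [mul_add]
  rw [canonMean_add, canonMean_gradA_mul_corrector, add_zero, canonMean_gradA_mul θ' ζ]
  simp only [canonMean_gradient_mul_moment, Finset.mul_sum]
  refine Finset.sum_congr rfl fun x _ => Finset.sum_congr rfl fun y _ => ?_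
  split_ifs
  · ring
  · simp

theorem abs_sq_occ_sub_le (a b : Bool) : |(occ a - occ b) ^ 2| ≤ 1 := by
  cases a <;> cases b <;> simp [occ]

theorem dependsOn_pair (x y : Site d) : DependsOn (fun η : Config d => (occ (η y) - occ (η x)) ^ 2)
    ((insert x {y} : Finset (Site d)) : Set (Site d)) := by
  intro η η' h
  have hx : η x = η' x := h x (by simp)
  have hy : η y = η' y := h y (by simp)
  simp only [hx, hy]

theorem integral_sq_gradient (ρ : unitInterval) {x y : Site d} (hxy : x ≠ y) :
    ∫ η : Config d, (occ (η y) - occ (η x)) ^ 2 ∂bernoulliProd d ρ =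
      2 * compressibility ρ := by
  have hdep := dependsOn_pair x y
  have h2 : ∀ b, DependsOn (fun η : Config d => (occ (Function.update η x b y) -
      occ (Function.update η x b x)) ^ 2) ((insert y ∅ : Finset (Site d)) : Set (Site d)) :=
    fun b => dependsOn_update hdep b
  rw [integral_bernoulliProd_update ρ x hdep, integral_bernoulliProd_update ρ y (h2 true),
    integral_bernoulliProd_update ρ y (h2 false)]
  simp [hxy.symm, occ, compressibility]
  ring

theorem abs_gradSq_sub_le (hm : m ≤ boxVol d ℓ) (ζ : {x : Site d // x ∉ box d ℓ} → Bool)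
    {x y : Site d} (hx : x ∈ box d ℓ) (hy : y ∈ box d ℓ) (hxy : x ≠ y) :
    |gradSq ℓ m ζ x y - 2 * compressibility (density hm)| ≤ 10 / boxVol d ℓ := by
  have hdep := dependsOn_pair x y
  have hsub : (insert x {y} : Finset (Site d)) ⊆ box d ℓ := by
    simp [Finset.insert_subset_iff, hx, hy]
  have h := abs_urnMean_sub_integral_le (m := m) (density hm) (U := box d ℓ)
    (by rw [card_box]; rfl) hsub (by rw [card_box]; exact hm) hdep
    fun η => abs_sq_occ_sub_le (η y) (η x)
  rw [integral_sq_gradient _ hxy, ← canonMean_glue ζ (hdep.mono (by exact_mod_cast hsub)),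
    card_box, Finset.card_pair hxy] at h
  norm_num at h
  exact h

theorem abs_compressibility_le (ρ : unitInterval) : |2 * compressibility ρ| ≤ 1 := by
  have h0 := ρ.2.1
  have h1 := ρ.2.2
  unfold compressibility
  rw [abs_le]
  constructor <;> nlinarith [sq_nonneg ((ρ : ℝ) - 1 / 2)]

theorem exists_errQ5_bound (hd : 1 ≤ d) (c : Rates d) :
    ∃ C : ℝ, 0 < C ∧ ∀ (F : LocalFun d) (ℓ : ℕ), 1 ≤ ℓ → ∀ θ θ' : Vec d, ‖θ‖ = 1 → ‖θ'‖ = 1 →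
      ∀ (m : ℕ) (hm : m ≤ boxVol d ℓ) (ζ : {x : Site d // x ∉ box d ℓ} → Bool),
        |errQ5 c F ℓ θ θ' hm ζ| ≤ C * (ℓ : ℝ)⁻¹ := by
  -- `10 = 5·1·2` is the equivalence of ensembles for a function bounded by 1 of two sites; `2d` is
  -- the boundary layer of width 1.
  refine ⟨3 ^ d * (10 + 2 * d), by positivity, fun F ℓ hℓ θ θ' hθ hθ' m hm ζ => ?_⟩
  have hℓ0 : (0 : ℝ) < ℓ := by exact_mod_cast hℓ
  have hχ := abs_compressibility_le (density hm)
  have hv : ∀ e ∈ unitNbrs d, |inner ℝ θ' (toVec e) * inner ℝ θ (toVec e)| ≤ 1 := fun e he => by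
    rw [abs_mul]
    exact mul_le_one₀ (abs_inner_toVec_le hθ' he) (abs_nonneg _) (abs_inner_toVec_le hθ he)
  have key := abs_bond_average_sub_le hd hℓ (K := 1) le_rfl
    (h := fun x y => inner ℝ θ' (toVec (y - x)) * inner ℝ θ (toVec (y - x)) * gradSq ℓ m ζ x y)
    (t := fun e => inner ℝ θ' (toVec e) * inner ℝ θ (toVec e) *
      (2 * compressibility (density hm)))
    (M := 1) (ε := 10 / ℓ) (by positivity) zero_le_one ?_ ?_ ?_
  · rw [← Finset.sum_mul, sum_unitNbrs_inner_mul_inner] at key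
    have herr : errQ5 c F ℓ θ θ' hm ζ = (1 / 4) * ((boxVol d ℓ : ℝ)⁻¹ *
        (∑ x : box d ℓ, ∑ y : box d ℓ, if Nbr x.1 y.1 then
          inner ℝ θ' (toVec (y.1 - x.1)) * inner ℝ θ (toVec (y.1 - x.1)) * gradSq ℓ m ζ x y
          else 0) - 2 * inner ℝ θ θ' * (2 * compressibility (density hm))) := by
      unfold errQ5
      rw [cltVar_gradA_current_eq]
      ring
    rw [herr, abs_mul, abs_of_pos (by norm_num : (0 : ℝ) < 1 / 4)]
    have e : (3 : ℝ) ^ d * (10 / ℓ + 2 * 1 * (d * (1 : ℕ) / ℓ)) =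
        3 ^ d * (10 + 2 * d) * (ℓ : ℝ)⁻¹ := by
      push_cast; field_simp
    rw [e] at key
    have hpos := (abs_nonneg _).trans key
    linarith
  · intro x _ e he _
    rw [add_sub_cancel_left, abs_mul]
    exact mul_le_one₀ (hv e he) (abs_nonneg _)
      (abs_canonMean_le zero_le_one fun ξ => abs_sq_occ_sub_le _ _)
  · intro e he
    rw [abs_mul]
    exact mul_le_one₀ (hv e he) (abs_nonneg _) hχ
  · intro x hx e he
    have hx' : x ∈ box d ℓ := box_mono (sub_le_self _ (Int.natCast_nonneg _)) hx
    have hy : x + e ∈ box d ℓ := add_mem_box hx (unitNbrs_subset he) (by push_cast; omega)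
    have hne : x ≠ x + e := by
      intro h
      exact (mem_unitNbrs.1 he).ne (left_eq_add.1 h).symm
    have h1 := abs_gradSq_sub_le hm ζ hx' hy hne
    have h2 := le_boxVol hd ℓ
    rw [add_sub_cancel_left, ← mul_sub, abs_mul]
    calc _ ≤ 1 * (10 / (boxVol d ℓ : ℝ)) := by
          gcongr
          exact hv e he
      _ ≤ 10 / ℓ := by rw [one_mul]; gcongr

end Gradient
end NonGradientKawasaki

/-! ### The proposition -/

open NonGradientKawasaki
theorem proposition5p1 (d : ℕ) (c : Rates d) :
    ∃ C : ℝ, 0 < C ∧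
      ∀ (F : LocalFun d) (ℓ : ℕ), 1 ≤ ℓ →
      ∀ (θ θ' : Vec d), ‖θ‖ = 1 → ‖θ'‖ = 1 →
      ∀ (m : ℕ) (hm : m ≤ boxVol d ℓ) (ζ : {x : Site d // x ∉ box d ℓ} → Bool),
        |errQ4 c F ℓ θ hm ζ|
            ≤ C * (F.radius : ℝ) ^ d * (1 + F.tripleNorm ^ 2) * (ℓ : ℝ)⁻¹ ∧
        |errQ5 c F ℓ θ θ' hm ζ|
            ≤ C * (F.radius : ℝ) ^ (2 * d) * F.supNorm * ((ℓ : ℝ) ^ d)⁻¹ + C * (ℓ : ℝ)⁻¹ := by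
  -- In dimension zero there are no unit vectors, and the claim is vacuous.
  rcases Nat.eq_zero_or_pos d with rfl | hd
  · refine ⟨1, one_pos, fun F ℓ _ θ _ hθ => ?_⟩
    rw [Subsingleton.elim θ 0, norm_zero] at hθ
    exact absurd hθ zero_ne_one
  obtain ⟨C₁, hC₁, h₁⟩ := exists_errQ4_bound hd c
  obtain ⟨C₂, hC₂, h₂⟩ := exists_errQ5_bound hd c
  refine ⟨C₁ + C₂, by positivity, fun F ℓ hℓ θ θ' hθ hθ' m hm ζ => ⟨?_, ?_⟩⟩
  · refine (h₁ F ℓ hℓ θ hθ m hm ζ).trans ?_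
    gcongr
    linarith
  · refine (h₂ F ℓ hℓ θ θ' hθ hθ' m hm ζ).trans ?_
    -- The covariance estimate holds with error `C/ℓ` alone; the term with `F` only has to be
    -- nonnegative.
    have h3 : 0 ≤ (C₁ + C₂) * (F.radius : ℝ) ^ (2 * d) * F.supNorm * ((ℓ : ℝ) ^ d)⁻¹ := by
      have := F.supNorm_nonneg
      positivity
    have h4 : C₂ * (ℓ : ℝ)⁻¹ ≤ (C₁ + C₂) * (ℓ : ℝ)⁻¹ := by
      gcongr
      linarith
    linarith
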